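/- For a finite simple graph $\mathcal G$ with vertex set $v(\mathcal G)$ and $e(\mathcal G)$ edges, let $A$ and $D$ be its adjacency matrix and its diagonal degree matrix, and put $\Delta(\mathcal G)=2e(\mathcal G)/|v(\mathcal G)|$. Define $$E(\mathcal G)=\sum_{\alpha}|\alpha|,\qquad LE(\mathcal G)=\sum_{\beta}|\beta-\Delta(\mathcal G)|,\qquad LE^+(\mathcal G)=\sum_{\gamma}|\gamma-\Delta(\mathcal G)|,$$ where $\alpha,\beta,\gamma$ run over the eigenvalues, with multiplicity, of $A$, $D-A$ and $D+A$ respectively. With $K$ the complete graph on $|v(\mathcal G)|$ vertices, $\mathcal G$ is called borderenergetic (resp. hyperenergetic) if $E(\mathcal G)=E(K)$ (resp. $E(\mathcal G)>E(K)$); L-borderenergetic (resp. L-hyperenergetic) if $LE(\mathcal G)=LE(K)$ (resp. $LE(\mathcal G)>LE(K)$); and Q-borderenergetic (resp. Q-hyperenergetic) if $LE^+(\mathcal G)=LE^+(K)$ (resp. $LE^+(\mathcal G)>LE^+(K)$). For a finite non-abelian group $G$ with center $Z(G)$, the NCCC-graph $\Gamma_G$ is the simple graph whose vertices are the conjugacy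 classes $x^G$ of the elements $x\in G\setminus Z(G)$, two classes $x^G$ and $y^G$ being adjacent if $x'y'\neq y'x'$ for all $x'\in x^G$ and $y'\in y^G$. Consider the groups - $D_{2m}=\langle x,y\mid x^m=y^2=1,\ yxy^{-1}=x^{-1}\rangle$ with $m\ge 3$, - $T_{4m}=\langle x,y\mid x^{2m}=1,\ x^m=y^2,\ y^{-1}xy=x^{-1}\rangle$ with $m\ge 2$, - $SD_{8m}=\langle x,y\mid x^{4m}=y^2=1,\ yxy=x^{2m-1}\rangle$ with $m\ge 2$, - $U_{(n,m)}=\langle x,y\mid x^{2n}=y^m=1,\ x^{-1}yx=y^{-1}\rangle$ with $n\ge 2$ and $m\ge 3$. **Corollary 4.4.** Let $G$ be isomorphic to one of these groups. Then, up to isomorphism of $G$: 1. $\Gamma_G$ is borderenergetic if and only if $G$ is $D_6$, $D_8$ or $T_8$. 2. $\Gamma_G$ is not hyperenergetic. 3. $\Gamma_G$ is L-borderenergetic if and only if $G$ is $D_6$, $D_8$ or $T_8$. 4. $\Gamma_G$ is not L-hyperenergetic if and only if $G$ is one of the following: $D_6$, $D_8$, $T_8$; $D_{2m}$ with $m\ge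 5$ odd; $D_{12}$, $D_{20}$; $T_{12}$, $T_{20}$; $SD_{24}$; $U_{(n,m)}$ with $m\in\{3,4,6\}$ and $n\ge 2$; $U_{(2,5)}$. 5. $\Gamma_G$ is Q-borderenergetic if and only if $G$ is $D_6$, $D_8$ or $T_8$. 6. $\Gamma_G$ is not Q-hyperenergetic if and only if $G$ is one of the following: $D_6$, $D_8$, $T_8$; $D_{2m}$ with $m\ge 5$ odd; $D_{12}$, $D_{16}$, $D_{20}$; $T_{12}$, $T_{16}$, $T_{20}$; $SD_{16}$, $SD_{24}$; $U_{(n,m)}$ with $m\in\{3,4,6\}$ and $n\ge 2$; $U_{(2,5)}$. -/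

import Mathlib

noncomputable section

namespace NCCC

/-! ### The groups given by presentations -/

/-- Relators of `⟨x, y ∣ x ^ (4 m) = y ^ 2 = 1, y x y = x ^ (2 m - 1)⟩`, with `x = of 0`, `y = of 1`. -/
def semidihedralRels (m : ℕ) : Set (FreeGroup (Fin 2)) :=
  {FreeGroup.of 0 ^ (4 * m),
   FreeGroup.of 1 ^ 2,
   FreeGroup.of 1 * FreeGroup.of 0 * FreeGroup.of 1 * (FreeGroup.of 0 ^ (2 * m - 1))⁻¹}

/-- The semidihedral group `SD_{8m}` of order `8 m` (used for `m ≥ 2`). -/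
abbrev SemidihedralGroup (m : ℕ) : Type := PresentedGroup (semidihedralRels m)

/-- Relators of `⟨x, y ∣ x ^ (2 n) = y ^ m = 1, x⁻¹ y x = y⁻¹⟩`, with `x = of 0`, `y = of 1`. -/
def uRels (n m : ℕ) : Set (FreeGroup (Fin 2)) :=
  {FreeGroup.of 0 ^ (2 * n),
   FreeGroup.of 1 ^ m,
   (FreeGroup.of 0)⁻¹ * FreeGroup.of 1 * FreeGroup.of 0 * ((FreeGroup.of 1)⁻¹)⁻¹}

/-- The group `U_{(n,m)}` of order `2 n m` (used for `n ≥ 2` and `m ≥ 3`). -/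
abbrev UGroup (n m : ℕ) : Type := PresentedGroup (uRels n m)

/-- `G` is one of `D_{2m}` (`m ≥ 3`), `T_{4m}` (`m ≥ 2`), `SD_{8m}` (`m ≥ 2`), `U_{(n,m)}`
(`n ≥ 2`, `m ≥ 3`), up to isomorphism. Mathlib's `DihedralGroup m` has order `2 m`, and its
`QuaternionGroup m` is the dicyclic group of order `4 m`. -/
def IsFamilyMember (G : Type*) [Group G] : Prop :=
  (∃ m : ℕ, 3 ≤ m ∧ Nonempty (G ≃* DihedralGroup m)) ∨
  (∃ m : ℕ, 2 ≤ m ∧ Nonempty (G ≃* QuaternionGroup m)) ∨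
  (∃ m : ℕ, 2 ≤ m ∧ Nonempty (G ≃* SemidihedralGroup m)) ∨
  (∃ n m : ℕ, 2 ≤ n ∧ 3 ≤ m ∧ Nonempty (G ≃* UGroup n m))

/-! ### The non-commuting conjugacy class graph -/

/-- The conjugacy classes of the non-central elements of `G`. -/
abbrev Vertex (G : Type*) [Group G] : Type _ :=
  {c : ConjClasses G // ∃ x : G, x ∉ Subgroup.center G ∧ ConjClasses.mk x = c}

instance {G : Type*} [Group G] [Finite G] : Fintype (Vertex G) := Fintype.ofFinite _

/-- The NCCC-graph `Γ_G`: two classes are adjacent when no element of the one commutes with an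
element of the other. -/
def graph (G : Type*) [Group G] : SimpleGraph (Vertex G) where
  Adj c d := ∀ x ∈ c.1.carrier, ∀ y ∈ d.1.carrier, x * y ≠ y * x
  symm := ⟨fun _ _ hcd x hx y hy e => hcd y hy x hx e.symm⟩
  loopless := ⟨fun c hc => by
    obtain ⟨x, hx⟩ := ConjClasses.exists_rep c.1
    have hm : x ∈ c.1.carrier := ConjClasses.mem_carrier_iff_mk_eq.2 hx
    exact hc x hm x hm rfl⟩

/-! ### Spectra and energies of a finite simple graph

The three matrices are real symmetric, so the multiset of real roots of the characteristic
polynomial is the full spectrum with multiplicities. -/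

section Energy

open scoped Classical

variable {V : Type*} [Fintype V] (Γ : SimpleGraph V)

/-- The spectrum: eigenvalues of the adjacency matrix `A`, with multiplicity. -/
def spec : Multiset ℝ := (Γ.adjMatrix ℝ).charpoly.roots

/-- The Laplacian spectrum: eigenvalues of `D - A`, with multiplicity. -/
def lSpec : Multiset ℝ := (Γ.degMatrix ℝ - Γ.adjMatrix ℝ).charpoly.roots

/-- The signless Laplacian spectrum: eigenvalues of `D + A`, with multiplicity. -/
def qSpec : Multiset ℝ := (Γ.degMatrix ℝ + Γ.adjMatrix ℝ).charpoly.roots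

/-- The average degree `2 e / |v|`. -/
def avgDegree : ℝ := 2 * (Γ.edgeFinset.card : ℝ) / (Fintype.card V : ℝ)

/-- The energy. -/
def energy : ℝ := ((spec Γ).map fun a => |a|).sum

/-- The Laplacian energy. -/
def lEnergy : ℝ := ((lSpec Γ).map fun b => |b - avgDegree Γ|).sum

/-- The signless Laplacian energy. -/
def qEnergy : ℝ := ((qSpec Γ).map fun c => |c - avgDegree Γ|).sum

/-- The complete graph with as many vertices as `Γ`. -/
abbrev completeOn (_Γ : SimpleGraph V) : SimpleGraph (Fin (Fintype.card V)) :=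
  SimpleGraph.completeGraph (Fin (Fintype.card V))

def IsBorderenergetic : Prop := energy Γ = energy (completeOn Γ)

def IsHyperenergetic : Prop := energy Γ > energy (completeOn Γ)

def IsLBorderenergetic : Prop := lEnergy Γ = lEnergy (completeOn Γ)

def IsLHyperenergetic : Prop := lEnergy Γ > lEnergy (completeOn Γ)

def IsQBorderenergetic : Prop := qEnergy Γ = qEnergy (completeOn Γ)

def IsQHyperenergetic : Prop := qEnergy Γ > qEnergy (completeOn Γ)

end Energy

end NCCC

end

/-! ### Spectra of matrices that depend only on a colouring of the index set -/

namespace NCCC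
open Polynomial

/-! Every group in the four families has an abelian subgroup `A` of index two, and conjugation by an
element `t` outside it acts on `A` as an involution `σ ≠ 1`. The non-central classes inside `A` are
the pairs `{a, σ a}`; those outside are the sets `(a + im(1 - σ)) t`. Two inner classes never are
adjacent, an inner and an outer class always are, and two outer classes are non-adjacent exactly
when their representatives agree modulo `im(1 - σ) + ker(1 - σ)`. So the graph is complete
multipartite: one inner part, and one outer part for each coset of that subgroup, which here has
index one or two (`isBipartiteOf`, `isTripartiteOf`).

Counting fixed points of `σ` gives the parts. Every family member yields `K_{1,b}`, `K_{n,nj}`,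
`K_{1,1,k}` or `K_{n,n,nk}` with `n ≥ 2` and `k` odd.

For a complete multipartite graph `A`, `D - A` and `D + A` are a diagonal matrix plus a matrix
depending on colours only. `charpoly_equitable` splits the characteristic polynomial into explicit
linear factors and that of a quotient matrix of size two or three, so all energies have closed
forms. The complete graph on `N` vertices has all three energies equal to `2 (N - 1)`, and the
result becomes elementary inequalities in the part sizes, collected in the `Verdict` lemmas. -/

/-- The number of vertices of colour `i`. -/
def fibreCard {V ι : Type*} [Fintype V] [DecidableEq ι] (c : V → ι) (i : ι) : ℕ :=
  (Finset.univ.filter fun v => c v = i).card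

/-- With `P` the vertex-colour incidence matrix, `B.submatrix c c = P B Pᵀ`. For `t` outside the
finite set of values of `d`, the factor `t - d` can be taken out, and `det (1 - UV) = det (1 - VU)`
trades a determinant over `V` for one over `ι`. Agreement at infinitely many `t` gives equality of
polynomials. One factor `t - d i` per colour is absorbed by the quotient determinant, whence the
exponent `fibreCard c i - 1`. -/
theorem charpoly_equitable {V ι : Type*} [Fintype V] [DecidableEq V] [Fintype ι] [DecidableEq ι]
    (c : V → ι) (hc : ∀ i, 0 < fibreCard c i) (d : ι → ℝ) (B : Matrix ι ι ℝ) :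
    (Matrix.diagonal (fun v => d (c v)) + B.submatrix c c).charpoly =
      (∏ i, (X - C (d i)) ^ (fibreCard c i - 1)) *
        (Matrix.diagonal d + B * Matrix.diagonal fun i => (fibreCard c i : ℝ)).charpoly := by
  classical
  apply Polynomial.eq_of_infinite_eval_eq
  have hfin : (Set.range d).Finite := Set.finite_range d
  refine hfin.infinite_compl.mono ?_
  intro t ht
  have htd : ∀ i, t - d i ≠ 0 := fun i h => ht ⟨i, by linarith⟩
  set P : Matrix V ι ℝ := Matrix.of fun v i => if c v = i then 1 else 0 with hP
  set e : V → ℝ := fun v => (t - d (c v))⁻¹ with he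
  have hPBP : B.submatrix c c = P * B * P.transpose := by
    ext v w
    simp [hP, Matrix.mul_apply]
  have hPEP : P.transpose * (Matrix.diagonal e * P) =
      Matrix.diagonal fun i => (fibreCard c i : ℝ) * (t - d i)⁻¹ := by
    ext i j
    rw [Matrix.mul_apply]
    simp only [Matrix.diagonal_mul, Matrix.transpose_apply, hP, Matrix.of_apply, he]
    by_cases hij : i = j
    · subst hij
      rw [Matrix.diagonal_apply_eq, fibreCard, Finset.card_filter]
      push_cast
      rw [Finset.sum_mul]
      refine Finset.sum_congr rfl fun v _ => ?_
      split_ifs with h <;> simp [h]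
    · rw [Matrix.diagonal_apply_ne _ hij]
      refine Finset.sum_eq_zero fun v _ => ?_
      split_ifs with h h' <;> simp_all
  have hM : Matrix.scalar V t - (Matrix.diagonal (fun v => d (c v)) + B.submatrix c c) =
      Matrix.diagonal (fun v => t - d (c v)) * (1 - (Matrix.diagonal e * P) * (B * P.transpose)) := by
    rw [hPBP, Matrix.mul_sub, Matrix.mul_one, ← Matrix.mul_assoc, ← Matrix.mul_assoc,
      ← Matrix.mul_assoc, Matrix.diagonal_mul_diagonal]
    have : (fun i => (t - d (c i)) * e i) = fun _ => (1 : ℝ) := by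
      funext v; exact mul_inv_cancel₀ (htd _)
    rw [this, Matrix.diagonal_one, Matrix.one_mul, ← sub_sub]
    congr 1
    ext v w
    by_cases h : v = w <;> simp [h, Matrix.diagonal]
  have hQ : Matrix.scalar ι t - (Matrix.diagonal d + B * Matrix.diagonal fun i => (fibreCard c i : ℝ)) =
      (1 - (B * P.transpose) * (Matrix.diagonal e * P)) * Matrix.diagonal (fun i => t - d i) := by
    rw [Matrix.mul_assoc, hPEP, Matrix.sub_mul, Matrix.one_mul, Matrix.mul_assoc,
      Matrix.diagonal_mul_diagonal, ← sub_sub]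
    congr 1
    · ext v w
      by_cases h : v = w <;> simp [h, Matrix.diagonal]
    · congr 2
      funext i
      rw [mul_assoc, inv_mul_cancel₀ (htd i), mul_one]
  have hprod : ∏ v, (t - d (c v)) = ∏ i, (t - d i) ^ fibreCard c i := by
    rw [← Finset.prod_fiberwise Finset.univ c]
    refine Finset.prod_congr rfl fun i _ => ?_
    rw [fibreCard, ← Finset.prod_const]
    refine Finset.prod_congr rfl fun v hv => ?_
    rw [(Finset.mem_filter.1 hv).2]
  simp only [Set.mem_ofPred_eq, eval_mul, Matrix.eval_charpoly, eval_prod, eval_pow, eval_sub, eval_X,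
    eval_C]
  rw [hM, hQ, Matrix.det_mul, Matrix.det_mul, Matrix.det_one_sub_mul_comm, Matrix.det_diagonal,
    Matrix.det_diagonal, hprod, mul_comm (Matrix.det _) (∏ i, _), ← mul_assoc,
    ← Finset.prod_mul_distrib]
  congr 1
  refine Finset.prod_congr rfl fun i _ => ?_
  rw [← pow_succ, Nat.sub_add_cancel (hc i)]

/-- The sum of the distances from `δ` of the eigenvalues of `M`. -/
noncomputable def absDev {V : Type*} [Fintype V] [DecidableEq V] (M : Matrix V V ℝ) (δ : ℝ) : ℝ :=
  (M.charpoly.roots.map fun a => |a - δ|).sum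

theorem absDev_equitable {V ι : Type*} [Fintype V] [DecidableEq V] [Fintype ι] [DecidableEq ι]
    (c : V → ι) (hc : ∀ i, 0 < fibreCard c i) (d : ι → ℝ) (B : Matrix ι ι ℝ) (δ : ℝ) :
    absDev (Matrix.diagonal (fun v => d (c v)) + B.submatrix c c) δ =
      ∑ i, ((fibreCard c i : ℝ) - 1) * |d i - δ| +
        absDev (Matrix.diagonal d + B * Matrix.diagonal fun i => (fibreCard c i : ℝ)) δ := by
  have h1 : (∏ i, (X - C (d i)) ^ (fibreCard c i - 1)) ≠ 0 :=
    Finset.prod_ne_zero_iff.2 fun i _ => pow_ne_zero _ (X_sub_C_ne_zero _)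
  unfold absDev
  rw [charpoly_equitable c hc, roots_mul (mul_ne_zero h1 (Matrix.charpoly_monic _).ne_zero),
    roots_prod _ _ h1, Multiset.map_add, Multiset.sum_add]
  congr 1
  simp only [roots_pow, roots_X_sub_C, Multiset.map_bind, Multiset.sum_bind, Multiset.map_nsmul,
    Multiset.map_singleton, Multiset.sum_nsmul, Multiset.sum_singleton, nsmul_eq_mul]
  change ∑ i, _ = _
  refine Finset.sum_congr rfl fun i _ => ?_
  rw [Nat.cast_sub (hc i), Nat.cast_one]

/-- Lets a guessed spectrum of a small quotient matrix be certified by a determinant identity in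
`t`. -/
theorem absDev_of_charpoly {V : Type*} [Fintype V] [DecidableEq V] {M : Matrix V V ℝ}
    {s : Multiset ℝ} (h : ∀ t, (Matrix.scalar V t - M).det = (s.map fun r => t - r).prod) (δ : ℝ) :
    absDev M δ = (s.map fun a => |a - δ|).sum := by
  have : M.charpoly = (s.map fun r => X - C r).prod := by
    refine Polynomial.funext fun t => ?_
    rw [Matrix.eval_charpoly, h, eval_multiset_prod, Multiset.map_map]
    simp
  rw [absDev, this, roots_multiset_prod_X_sub_C]

end NCCC

/-! ### Energies of complete graphs and of complete bipartite and tripartite graphs -/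

namespace NCCC
open Polynomial

section Colouring

set_option linter.unusedSectionVars false

open scoped Classical

variable {V ι : Type*} [Fintype V] [Fintype ι] [DecidableEq ι] {Γ : SimpleGraph V} {c : V → ι}

theorem energy_eq_absDev : energy Γ = absDev (Γ.adjMatrix ℝ) 0 := by
  simp [energy, spec, absDev]

theorem lEnergy_eq_absDev :
    lEnergy Γ = absDev (Γ.degMatrix ℝ - Γ.adjMatrix ℝ) (avgDegree Γ) := rfl

theorem qEnergy_eq_absDev :
    qEnergy Γ = absDev (Γ.degMatrix ℝ + Γ.adjMatrix ℝ) (avgDegree Γ) := rfl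

theorem sum_fibreCard (c : V → ι) : ∑ i, fibreCard c i = Fintype.card V := by
  simp only [fibreCard]
  rw [← Finset.card_univ]
  exact (Finset.card_eq_sum_card_fiberwise fun _ _ => Finset.mem_coe.2 (Finset.mem_univ _)).symm

theorem degree_eq_of_colouring (h : ∀ v w, Γ.Adj v w ↔ c v ≠ c w) (v : V) :
    (Γ.degree v : ℝ) = (Fintype.card V : ℝ) - fibreCard c (c v) := by
  have h1 : Γ.degree v = (Finset.univ.filter fun w => ¬ c w = c v).card := by
    rw [← SimpleGraph.card_neighborFinset_eq_degree]
    congr 1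
    ext w
    simp [h, eq_comm]
  have h2 := Finset.card_filter_add_card_filter_not (s := Finset.univ) (fun w => c w = c v)
  rw [← h1, Finset.card_univ] at h2
  have h3 : ((fibreCard c (c v) : ℕ) : ℝ) + Γ.degree v = Fintype.card V := by
    rw [← h2, fibreCard]; push_cast; congr
  linarith

theorem avgDegree_eq_of_degree (d : ι → ℝ) (h : ∀ v, (Γ.degree v : ℝ) = d (c v)) :
    avgDegree Γ = (∑ i, (fibreCard c i : ℝ) * d i) / Fintype.card V := by
  unfold avgDegree
  congr 1
  have := Γ.sum_degrees_eq_twice_card_edges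
  have h2 : (∑ v, (Γ.degree v : ℝ)) = 2 * (Γ.edgeFinset.card : ℝ) := by exact_mod_cast this
  rw [← h2, ← Finset.sum_fiberwise Finset.univ c]
  refine Finset.sum_congr rfl fun i _ => ?_
  rw [fibreCard, ← nsmul_eq_mul, ← Finset.sum_const]
  refine Finset.sum_congr rfl fun v hv => ?_
  rw [h, (Finset.mem_filter.1 hv).2]

/-- The part of the adjacency matrix that depends on colours only. -/
def offDiag (ι : Type*) [DecidableEq ι] : Matrix ι ι ℝ := Matrix.of fun i j => if i = j then 0 else 1

theorem adjMatrix_of_colouring (h : ∀ v w, Γ.Adj v w ↔ c v ≠ c w) :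
    Γ.adjMatrix ℝ = (offDiag ι).submatrix c c := by
  ext v w
  by_cases hvw : c v = c w <;> simp [offDiag, h, hvw]

/-- Degrees are constant on colours, namely `|V|` minus the part size, so `absDev_equitable` applies
to all three matrices. For the adjacency matrix the diagonal is zero, and the repeated eigenvalue
contributes nothing. -/
theorem energies_of_colouring (h : ∀ v w, Γ.Adj v w ↔ c v ≠ c w) (hc : ∀ i, 0 < fibreCard c i)
    (n : ι → ℝ) (hn : ∀ i, n i = fibreCard c i) :
    energy Γ = absDev (offDiag ι * Matrix.diagonal n) 0 ∧
    lEnergy Γ = ∑ i, (n i - 1) * |∑ j, n j - n i - avgDegree Γ| +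
      absDev (Matrix.diagonal (fun i => ∑ j, n j - n i) + (-offDiag ι) * Matrix.diagonal n)
        (avgDegree Γ) ∧
    qEnergy Γ = ∑ i, (n i - 1) * |∑ j, n j - n i - avgDegree Γ| +
      absDev (Matrix.diagonal (fun i => ∑ j, n j - n i) + offDiag ι * Matrix.diagonal n)
        (avgDegree Γ) ∧
    avgDegree Γ = (∑ i, n i * (∑ j, n j - n i)) / ∑ j, n j ∧
    (Fintype.card V : ℝ) = ∑ j, n j := by
  have hN : (Fintype.card V : ℝ) = ∑ j, n j := by
    rw [← sum_fibreCard c]; push_cast; simp [hn]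
  obtain rfl : n = fun i => (fibreCard c i : ℝ) := funext hn
  have hdeg : ∀ v, (Γ.degree v : ℝ) = ∑ j, (fibreCard c j : ℝ) - fibreCard c (c v) := fun v => by
    rw [degree_eq_of_colouring h, hN]
  have hD : Γ.degMatrix ℝ =
      Matrix.diagonal fun v => (fun i => ∑ j, (fibreCard c j : ℝ) - fibreCard c i) (c v) := by
    unfold SimpleGraph.degMatrix
    congr 1
    funext v; exact hdeg v
  refine ⟨?_, ?_, ?_, ?_, hN⟩
  · rw [energy_eq_absDev, adjMatrix_of_colouring h]
    have := absDev_equitable c hc (fun _ => 0) (offDiag ι) 0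
    simpa using this
  · rw [lEnergy_eq_absDev, hD, adjMatrix_of_colouring h, sub_eq_add_neg]
    exact absDev_equitable c hc (fun i => ∑ j, (fibreCard c j : ℝ) - fibreCard c i) (-offDiag ι) _
  · rw [qEnergy_eq_absDev, hD, adjMatrix_of_colouring h]
    exact absDev_equitable c hc (fun i => ∑ j, (fibreCard c j : ℝ) - fibreCard c i) (offDiag ι) _
  · rw [avgDegree_eq_of_degree (c := c) (fun i => ∑ j, (fibreCard c j : ℝ) - fibreCard c i) hdeg, hN]

theorem energies_top [Nonempty V] :
    energy (⊤ : SimpleGraph V) = 2 * ((Fintype.card V : ℝ) - 1) ∧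
    lEnergy (⊤ : SimpleGraph V) = 2 * ((Fintype.card V : ℝ) - 1) ∧
    qEnergy (⊤ : SimpleGraph V) = 2 * ((Fintype.card V : ℝ) - 1) := by
  obtain ⟨Γ, hΓ⟩ : ∃ Γ : SimpleGraph V, Γ = ⊤ := ⟨_, rfl⟩
  have hadj : ∀ v w, Γ.Adj v w ↔ v ≠ w := fun v w => by rw [hΓ, SimpleGraph.top_adj]
  rw [← hΓ]
  clear hΓ
  obtain ⟨N, hNV⟩ : ∃ N, N = Fintype.card V := ⟨_, rfl⟩
  rw [← hNV]
  -- A single colour: each matrix is `a I + b J` with `J` all ones, and the quotient is the `1 × 1`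
  -- matrix `a + b N`. The proper colouring by singletons would give no reduction.
  let c : V → Fin 1 := fun _ => 0
  have hf : ∀ i, fibreCard c i = N := fun i => by
    simp [fibreCard, c, Subsingleton.elim i 0, hNV]
  have hN : 0 < N := hNV ▸ Fintype.card_pos
  have hc : ∀ i, 0 < fibreCard c i := fun i => by rw [hf]; exact hN
  have hN1 : (1 : ℝ) ≤ N := by exact_mod_cast hN
  have hdeg : ∀ v, (Γ.degree v : ℝ) = (N : ℝ) - 1 := fun v => by
    rw [degree_eq_of_colouring (Γ := Γ) (c := id) hadj, ← hNV]
    have : fibreCard (id : V → V) v = 1 := Finset.card_eq_one.2 ⟨v, by ext; simp⟩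
    simp [this]
  have hD : Γ.degMatrix ℝ = Matrix.diagonal fun _ => (N : ℝ) - 1 := by
    unfold SimpleGraph.degMatrix
    congr 1
    funext v; exact hdeg v
  have hA : Γ.adjMatrix ℝ = Matrix.diagonal (fun _ => (-1 : ℝ)) + Matrix.of fun _ _ => (1 : ℝ) := by
    ext v w
    by_cases hvw : v = w <;> simp [hadj, hvw]
  have hav : avgDegree Γ = N - 1 := by
    rw [avgDegree_eq_of_degree (c := c) (fun _ => (N : ℝ) - 1) hdeg, ← hNV]
    simp only [hf, Finset.univ_unique, Finset.sum_const, Finset.card_singleton, one_smul]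
    field_simp
  have key : ∀ a b δ : ℝ, absDev (Matrix.diagonal (fun _ : V => a) + Matrix.of fun _ _ => b) δ =
      ((N : ℝ) - 1) * |a - δ| + |a + b * N - δ| := fun a b δ => by
    refine (absDev_equitable c hc (fun _ => a) (Matrix.of fun _ _ => b) δ).trans ?_
    rw [absDev_of_charpoly (s := {a + b * N})]
    · simp [hf]
    · intro t
      simp [hf]
  refine ⟨?_, ?_, ?_⟩
  · rw [energy_eq_absDev, hA, key, abs_of_nonpos (by norm_num), abs_of_nonneg (by linarith)]
    ring
  · have : Γ.degMatrix ℝ - Γ.adjMatrix ℝ =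
        Matrix.diagonal (fun _ => (N : ℝ)) + Matrix.of fun _ _ => (-1 : ℝ) := by
      rw [hD, hA]
      ext v w
      by_cases hvw : v = w <;> simp [hvw]
      ring
    rw [lEnergy_eq_absDev, this, key, hav, abs_of_nonneg (by linarith), abs_of_nonpos (by linarith)]
    ring
  · have : Γ.degMatrix ℝ + Γ.adjMatrix ℝ =
        Matrix.diagonal (fun _ => (N : ℝ) - 2) + Matrix.of fun _ _ => (1 : ℝ) := by
      rw [hD, hA]
      ext v w
      by_cases hvw : v = w <;> simp [hvw]
      ring
    rw [qEnergy_eq_absDev, this, key, hav, abs_of_nonpos (by linarith), abs_of_nonneg (by linarith)]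
    ring

theorem energies_completeOn [Nonempty V] (Γ : SimpleGraph V) :
    energy (completeOn Γ) = 2 * ((Fintype.card V : ℝ) - 1) ∧
    lEnergy (completeOn Γ) = 2 * ((Fintype.card V : ℝ) - 1) ∧
    qEnergy (completeOn Γ) = 2 * ((Fintype.card V : ℝ) - 1) := by
  have : Nonempty (Fin (Fintype.card V)) := ⟨⟨0, Fintype.card_pos⟩⟩
  simpa using energies_top (V := Fin (Fintype.card V))

/-- `Γ` is complete bipartite with parts of sizes `a` and `b`. -/
def IsBipartiteOf (Γ : SimpleGraph V) (a b : ℕ) : Prop :=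
  ∃ c : V → Fin 2, (∀ v w, Γ.Adj v w ↔ c v ≠ c w) ∧ fibreCard c 0 = a ∧ fibreCard c 1 = b

/-- `Γ` is complete tripartite with parts of sizes `a`, `a` and `b`. -/
def IsTripartiteOf (Γ : SimpleGraph V) (a b : ℕ) : Prop :=
  ∃ c : V → Fin 3, (∀ v w, Γ.Adj v w ↔ c v ≠ c w) ∧
    fibreCard c 0 = a ∧ fibreCard c 1 = a ∧ fibreCard c 2 = b

theorem IsBipartiteOf.energies {a b : ℕ} (h : IsBipartiteOf Γ a b) (ha : 0 < a) (hb : 0 < b) :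
    energy Γ = 2 * √(a * b) ∧
    lEnergy Γ = (|(b : ℝ) - a| * (2 * a * b - (a + b)) + (a + b) ^ 2) / (a + b) ∧
    qEnergy Γ = (|(b : ℝ) - a| * (2 * a * b - (a + b)) + (a + b) ^ 2) / (a + b) ∧
    Fintype.card V = a + b := by
  obtain ⟨c, hadj, h0, h1⟩ := h
  have hN : Fintype.card V = a + b := by
    rw [← sum_fibreCard c, Fin.sum_univ_two, h0, h1]
  have ha' : (0 : ℝ) < a := by exact_mod_cast ha
  have hb' : (0 : ℝ) < b := by exact_mod_cast hb
  obtain ⟨e1, e2, e3, e4, -⟩ := energies_of_colouring hadj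
    (by intro i; fin_cases i <;> simp [h0, h1, ha, hb]) ![(a : ℝ), b]
    (by intro i; fin_cases i <;> simp [h0, h1])
  simp only [Fin.sum_univ_two, Matrix.cons_val_zero, Matrix.cons_val_one] at e2 e3 e4
  generalize avgDegree Γ = δ at e2 e3 e4
  have hδ0 : 0 ≤ δ := by rw [e4]; ring_nf; positivity
  have k1 : (b : ℝ) - δ = (b - a) * (b / (a + b)) := by rw [e4]; field_simp; ring
  have k2 : (a : ℝ) - δ = (b - a) * (-(a / (a + b))) := by rw [e4]; field_simp; ring
  have k3 : (a : ℝ) + b - δ = (a ^ 2 + b ^ 2) / (a + b) := by rw [e4]; field_simp; ring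
  have fin : ((a : ℝ) - 1) * |(a + b : ℝ) - a - δ| + (b - 1) * |(a + b : ℝ) - b - δ| +
      (|0 - δ| + |(a + b : ℝ) - δ|) =
      (|(b : ℝ) - a| * (2 * a * b - (a + b)) + (a + b) ^ 2) / (a + b) := by
    have p1 : (0 : ℝ) ≤ b / (a + b) := by positivity
    have p2 : (0 : ℝ) ≤ a / (a + b) := by positivity
    have p3 : (0 : ℝ) ≤ (a ^ 2 + b ^ 2) / (a + b) := by positivity
    rw [add_sub_cancel_left, add_sub_cancel_right, k1, k2, k3, abs_mul, abs_mul, abs_neg,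
      abs_of_nonneg p1, abs_of_nonneg p2, abs_of_nonneg p3, zero_sub, abs_neg, abs_of_nonneg hδ0, e4]
    field_simp
    ring
  refine ⟨?_, ?_, ?_, hN⟩
  · rw [e1, absDev_of_charpoly (s := {√(a * b), -√(a * b)})]
    · simp [abs_of_nonneg (Real.sqrt_nonneg _)]; ring
    · intro t
      have := Real.sq_sqrt (show (0 : ℝ) ≤ a * b by positivity)
      simp only [Matrix.det_fin_two, Matrix.sub_apply, Matrix.mul_diagonal, offDiag]
      generalize √((a : ℝ) * b) = s at this ⊢
      simp
      linear_combination this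
  -- The Laplacian and signless Laplacian quotients have the same eigenvalues, as the graph is
  -- bipartite; hence `fin` serves both.
  · rw [e2, absDev_of_charpoly (s := {0, (a + b : ℝ)})]
    · simpa using fin
    · intro t
      simp only [Matrix.det_fin_two, Matrix.sub_apply, Matrix.add_apply, Matrix.mul_diagonal, offDiag]
      simp
      ring
  · rw [e3, absDev_of_charpoly (s := {0, (a + b : ℝ)})]
    · simpa using fin
    · intro t
      simp only [Matrix.det_fin_two, Matrix.sub_apply, Matrix.add_apply, Matrix.mul_diagonal, offDiag]
      simp
      ring

set_option maxHeartbeats 1000000 in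
theorem IsTripartiteOf.energies {a b : ℕ} (h : IsTripartiteOf Γ a b) (ha : 0 < a) (hab : a ≤ b) :
    energy Γ = a + √((a : ℝ) ^ 2 + 8 * a * b) ∧
    lEnergy Γ = (((b : ℝ) - a) * (4 * a * b - 2 * a - 2 * b) + 6 * a ^ 2 + 2 * b ^ 2 + 4 * a * b) /
      (2 * a + b) ∧
    qEnergy Γ = (((b : ℝ) - a) * (4 * a * b - 2 * a - 2 * b) +
      |(b : ℝ) ^ 2 - 2 * a * b - 2 * a ^ 2|) / (2 * a + b) + √((b : ℝ) ^ 2 + 8 * a * b) ∧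
    Fintype.card V = 2 * a + b := by
  obtain ⟨c, hadj, h0, h1, h2⟩ := h
  have hb : 0 < b := by omega
  have hN : Fintype.card V = 2 * a + b := by
    rw [← sum_fibreCard c, Fin.sum_univ_three, h0, h1, h2]; ring
  have ha' : (0 : ℝ) < a := by exact_mod_cast ha
  have hb' : (0 : ℝ) < b := by exact_mod_cast hb
  have hab' : (a : ℝ) ≤ b := by exact_mod_cast hab
  obtain ⟨e1, e2, e3, e4, -⟩ := energies_of_colouring hadj
    (by intro i; fin_cases i <;> simp [h0, h1, h2, ha, hb]) ![(a : ℝ), a, b]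
    (by intro i; fin_cases i <;> simp [h0, h1, h2])
  simp only [Fin.sum_univ_three, Matrix.cons_val_zero, Matrix.cons_val_one, Matrix.cons_val] at e2 e3 e4
  generalize avgDegree Γ = δ at e2 e3 e4
  have hδ : δ = (2 * a ^ 2 + 4 * a * b) / (2 * a + b) := by rw [e4]; congr 1 <;> ring
  have hδ0 : 0 ≤ δ := by rw [hδ]; positivity
  have k1 : (a : ℝ) + b - δ = (b - a) * (b / (2 * a + b)) := by rw [hδ]; field_simp; ring
  have k2 : 2 * (a : ℝ) - δ = (b - a) * (-(2 * a / (2 * a + b))) := by rw [hδ]; field_simp; ring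
  have k3 : 2 * (a : ℝ) + b - δ = (2 * a ^ 2 + b ^ 2) / (2 * a + b) := by rw [hδ]; field_simp; ring
  have k4 : (b : ℝ) - δ = (b ^ 2 - 2 * a * b - 2 * a ^ 2) / (2 * a + b) := by
    rw [hδ]; field_simp; ring
  have p0 : (0 : ℝ) ≤ b - a := by linarith
  have p1 : (0 : ℝ) ≤ b / (2 * a + b) := by positivity
  have p2 : (0 : ℝ) ≤ 2 * a / (2 * a + b) := by positivity
  have p3 : (0 : ℝ) ≤ (2 * a ^ 2 + b ^ 2) / (2 * a + b) := by positivity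
  have q1 : |(a : ℝ) + a + b - a - δ| = (b - a) * (b / (2 * a + b)) := by
    rw [show (a : ℝ) + a + b - a - δ = a + b - δ by ring, k1, abs_of_nonneg (mul_nonneg p0 p1)]
  have q2 : |(a : ℝ) + a + b - b - δ| = (b - a) * (2 * a / (2 * a + b)) := by
    rw [show (a : ℝ) + a + b - b - δ = 2 * a - δ by ring, k2, abs_mul, abs_neg, abs_of_nonneg p2,
      abs_of_nonneg p0]
  have q3 : |2 * (a : ℝ) + b - δ| = (2 * a ^ 2 + b ^ 2) / (2 * a + b) := by
    rw [k3, abs_of_nonneg p3]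
  rw [q1, q2] at e2 e3
  refine ⟨?_, ?_, ?_, hN⟩
  · set s := √((a : ℝ) ^ 2 + 8 * a * b) with hs
    have hs2 : s ^ 2 = (a : ℝ) ^ 2 + 8 * a * b := Real.sq_sqrt (by positivity)
    have hsa : (a : ℝ) ≤ s := Real.le_sqrt_of_sq_le (by nlinarith)
    -- The eigenvalue `-a` belongs to the vector `(1, -1, 0)` separating the two equal parts; the
    -- other two come from the vectors symmetric in these parts.
    rw [e1, absDev_of_charpoly (s := {-(a : ℝ), (a + s) / 2, (a - s) / 2})]
    · simp only [Multiset.insert_eq_cons, Multiset.map_cons, Multiset.map_singleton, Multiset.sum_cons,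
        Multiset.sum_singleton, sub_zero]
      rw [abs_neg, abs_of_pos ha', abs_of_nonneg (by linarith), abs_of_nonpos (by linarith)]
      ring
    · intro t
      simp only [Matrix.det_fin_three, Matrix.sub_apply, Matrix.mul_diagonal, offDiag]
      simp
      linear_combination ((t + a) / 4) * hs2
  · rw [e2, absDev_of_charpoly (s := {0, (2 * a + b : ℝ), (2 * a + b : ℝ)})]
    · simp only [Multiset.insert_eq_cons, Multiset.map_cons, Multiset.map_singleton, Multiset.sum_cons,
        Multiset.sum_singleton]
      rw [q3, zero_sub, abs_neg, abs_of_nonneg hδ0, hδ]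
      field_simp
      ring
    · intro t
      simp only [Matrix.det_fin_three, Matrix.sub_apply, Matrix.add_apply, Matrix.mul_diagonal, offDiag]
      simp
      ring
  · set s := √((b : ℝ) ^ 2 + 8 * a * b) with hs
    have hs2 : s ^ 2 = (b : ℝ) ^ 2 + 8 * a * b := Real.sq_sqrt (by positivity)
    have hsb : (b : ℝ) ≤ s := Real.le_sqrt_of_sq_le (by nlinarith)
    -- The average degree lies between the eigenvalues `(4 a + b ± s) / 2`, which settles the signs
    -- of two absolute values.
    have hδle : δ ≤ (4 * a + b) / 2 := by
      rw [hδ, div_le_div_iff₀ (by positivity) (by norm_num)]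
      nlinarith
    have hδge : (4 * a + b - s) / 2 ≤ δ := by
      have : 4 * a * (2 * a + b) + b ^ 2 - 4 * a ^ 2 ≤ s * (2 * a + b) + 2 * a * b := by
        have hx : (b : ℝ) ^ 2 + 4 * a ^ 2 + 2 * a * b ≤ s * (2 * a + b) := by
          refine (sq_le_sq₀ (by positivity) (by positivity)).1 ?_
          -- This is the difference of the two squares being compared.
          have h3 : (0 : ℝ) ≤ 16 * a ^ 3 * (b - a) + 8 * a * b ^ 3 + 24 * a ^ 2 * b ^ 2 := by
            positivity
          rw [mul_pow, hs2]
          linarith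
        linarith
      rw [hδ, div_le_div_iff₀ (by norm_num) (by positivity)]
      nlinarith
    rw [e3, absDev_of_charpoly (s := {(b : ℝ), (4 * a + b + s) / 2, (4 * a + b - s) / 2})]
    · simp only [Multiset.insert_eq_cons, Multiset.map_cons, Multiset.map_singleton, Multiset.sum_cons,
        Multiset.sum_singleton]
      rw [k4, abs_div, abs_of_pos (show (0 : ℝ) < 2 * a + b by positivity),
        abs_of_nonneg (show 0 ≤ (4 * a + b + s) / 2 - δ by linarith), abs_of_nonpos (show (4 * a + b - s) / 2 - δ ≤ 0 by linarith)]
      field_simp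
      ring
    · intro t
      simp only [Matrix.det_fin_three, Matrix.sub_apply, Matrix.add_apply, Matrix.mul_diagonal, offDiag]
      simp
      linear_combination ((t - b) / 4) * hs2

end Colouring

end NCCC

/-! ### The graph of a group with an abelian subgroup of index two -/

namespace NCCC

/-- A description of `G` by an abelian subgroup `ι A` of index two and an element `t` outside it,
conjugation by which acts on `A` as `σ`. -/
structure TwistData (G : Type*) [Group G] {A : Type*} [AddCommGroup A] (σ : A →+ A) where
  ι : A → G
  t : G
  map_add : ∀ a b, ι (a + b) = ι a * ι b
  inj : Function.Injective ι
  conj : ∀ a, t * ι a = ι (σ a) * t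
  not_mem : ∀ a, ι a ≠ t
  cover : ∀ g, (∃ a, g = ι a) ∨ ∃ a, g = ι a * t

namespace TwistData

theorem adj_iff {G : Type*} [Group G] {v w : Vertex G} {x y : G} (hv : v.1 = ConjClasses.mk x)
    (hw : w.1 = ConjClasses.mk y) :
    (graph G).Adj v w ↔ ∀ x' y', IsConj x x' → IsConj y y' → x' * y' ≠ y' * x' := by
  change (∀ x' ∈ v.1.carrier, ∀ y' ∈ w.1.carrier, x' * y' ≠ y' * x') ↔ _
  simp only [ConjClasses.mem_carrier_iff_mk_eq, hv, hw, ConjClasses.mk_eq_mk_iff_isConj]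
  exact ⟨fun h x' y' hx hy => h x' hx.symm y' hy.symm, fun h x' hx y' hy => h x' y' hx.symm hy.symm⟩

/-- Double counting: sending `a` to the class of `g a` maps the indices satisfying `p` onto the
vertices of colour `i`, with all fibres of size `k`. -/
theorem card_eq_mul_fibreCard {G A ι : Type*} [Group G] [DecidableEq ι] [Finite G] [Finite A]
    (c : Vertex G → ι) (i : ι) (p : A → Prop) (g : A → G) (hg : ∀ a, p a → g a ∉ Subgroup.center G)
    (h : ∀ v, c v = i ↔ ∃ a, p a ∧ v.1 = ConjClasses.mk (g a)) (k : ℕ)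
    (hk : ∀ a, p a → Nat.card {b // p b ∧ IsConj (g a) (g b)} = k) :
    Nat.card {a // p a} = k * fibreCard c i := by
  classical
  have := Fintype.ofFinite A
  let f : {a // p a} → Vertex G := fun a => ⟨ConjClasses.mk (g a), g a, hg a a.2, rfl⟩
  rw [Nat.card_eq_fintype_card, ← Finset.card_univ,
    Finset.card_eq_sum_card_fiberwise (f := f) (t := Finset.univ.filter fun v => c v = i)]
  · rw [mul_comm, fibreCard]
    refine Finset.sum_const_nat fun v hv => ?_
    obtain ⟨a, ha, hva⟩ := (h v).1 (Finset.mem_filter.1 hv).2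
    rw [← hk a ha, Nat.card_eq_fintype_card, Fintype.card_subtype]
    refine Finset.card_bij (fun b _ => b.1) ?_ ?_ ?_
    · intro b hb
      have hb' := congrArg Subtype.val (Finset.mem_filter.1 hb).2
      simp only [f] at hb'
      rw [hva, ConjClasses.mk_eq_mk_iff_isConj] at hb'
      exact Finset.mem_filter.2 ⟨Finset.mem_univ _, b.2, hb'.symm⟩
    · intro b _ b' _ hbb
      exact Subtype.ext hbb
    · intro b hb
      obtain ⟨-, hpb, hcb⟩ := Finset.mem_filter.1 hb
      refine ⟨⟨b, hpb⟩, Finset.mem_filter.2 ⟨Finset.mem_univ _, Subtype.ext ?_⟩, rfl⟩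
      simp only [f]
      rw [hva, ConjClasses.mk_eq_mk_iff_isConj]
      exact hcb.symm
  · intro a _
    exact Finset.mem_coe.2 (Finset.mem_filter.2 ⟨Finset.mem_univ _, (h _).2 ⟨a, a.2, rfl⟩⟩)

theorem card_fixed_add {A : Type*} [AddCommGroup A] (σ : A →+ A) [Finite A] : Nat.card {a // σ a = a} + Nat.card {a // σ a ≠ a} = Nat.card A := by
  classical
  rw [← Nat.card_sum]
  exact Nat.card_congr (Equiv.sumCompl fun a => σ a = a)

variable {G : Type*} [Group G] {A : Type*} [AddCommGroup A] {σ : A →+ A} (D : TwistData G σ)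

/-- Transport along an isomorphism. -/
def ofEquiv {H : Type*} [Group H] (e : H ≃* G) : TwistData H σ where
  ι a := e.symm (D.ι a)
  t := e.symm D.t
  map_add a b := by rw [D.map_add, map_mul]
  inj := e.symm.injective.comp D.inj
  conj a := by rw [← map_mul, D.conj, map_mul]
  not_mem a h := D.not_mem a (e.symm.injective h)
  cover g := by
    rcases D.cover (e g) with ⟨a, h⟩ | ⟨a, h⟩
    · exact Or.inl ⟨a, by rw [← h, e.symm_apply_apply]⟩
    · exact Or.inr ⟨a, by rw [← map_mul, ← h, e.symm_apply_apply]⟩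

include D

theorem map_zero : D.ι 0 = 1 := by
  have := D.map_add 0 0
  rwa [add_zero, left_eq_mul] at this

theorem map_neg (a : A) : D.ι (-a) = (D.ι a)⁻¹ := by
  rw [eq_inv_iff_mul_eq_one, ← D.map_add, neg_add_cancel, D.map_zero]

theorem ι_comm (a b : A) : D.ι a * D.ι b = D.ι b * D.ι a := by
  rw [← D.map_add, ← D.map_add, add_comm]

theorem ι_ne (a b : A) : D.ι a ≠ D.ι b * D.t := fun h => by
  apply D.not_mem (-b + a)
  rw [D.map_add, h, D.map_neg, inv_mul_cancel_left]

/-- The square of `t` lies in the abelian subgroup, so conjugation by it is trivial there. -/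
theorem σ_σ (a : A) : σ (σ a) = a := by
  obtain ⟨z, hz⟩ : ∃ z, D.t * D.t = D.ι z := by
    rcases D.cover (D.t * D.t) with h | ⟨a, h⟩
    · exact h
    · exact absurd (mul_right_cancel h).symm (D.not_mem a)
  have h : D.t * D.t * D.ι a = D.ι (σ (σ a)) * (D.t * D.t) := by
    rw [mul_assoc, D.conj, ← mul_assoc, D.conj, mul_assoc]
  rw [hz, D.ι_comm] at h
  exact (D.inj (mul_right_cancel h)).symm

theorem ι_mul_outer (a b : A) : D.ι a * (D.ι b * D.t) = D.ι (a + b) * D.t := by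
  rw [D.map_add, mul_assoc]

theorem outer_mul_ι (a b : A) : D.ι a * D.t * D.ι b = D.ι (a + σ b) * D.t := by
  rw [mul_assoc, D.conj, D.map_add, mul_assoc]

theorem outer_mul_outer (a b : A) :
    D.ι a * D.t * (D.ι b * D.t) = D.ι (a + σ b) * (D.t * D.t) := by
  rw [← mul_assoc, D.outer_mul_ι, mul_assoc]

theorem ι_comm_outer (a b : A) : D.ι a * (D.ι b * D.t) = D.ι b * D.t * D.ι a ↔ σ a = a := by
  rw [D.ι_mul_outer, D.outer_mul_ι, mul_left_inj, D.inj.eq_iff, add_comm, add_right_inj, eq_comm]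

theorem outer_comm_outer (a b : A) :
    D.ι a * D.t * (D.ι b * D.t) = D.ι b * D.t * (D.ι a * D.t) ↔ σ (a - b) = a - b := by
  rw [D.outer_mul_outer, D.outer_mul_outer, mul_left_inj, D.inj.eq_iff, map_sub]
  constructor <;> intro h
  · rw [sub_eq_sub_iff_add_eq_add, add_comm (σ a), ← h]
  · rw [sub_eq_sub_iff_add_eq_add] at h
    rw [← h, add_comm]

theorem isConj_ι {a : A} {g : G} : IsConj (D.ι a) g ↔ g = D.ι a ∨ g = D.ι (σ a) := by
  have ht : D.t * D.ι a * D.t⁻¹ = D.ι (σ a) := by rw [D.conj, mul_inv_cancel_right]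
  rw [isConj_iff]
  constructor
  · rintro ⟨x, rfl⟩
    rcases D.cover x with ⟨b, rfl⟩ | ⟨b, rfl⟩
    · left
      rw [D.ι_comm, mul_inv_cancel_right]
    · right
      have : D.ι b * D.t * D.ι a * (D.ι b * D.t)⁻¹ = D.ι b * (D.t * D.ι a * D.t⁻¹) * (D.ι b)⁻¹ := by
        group
      rw [this, ht, D.ι_comm, mul_inv_cancel_right]
  · rintro (rfl | rfl)
    · exact ⟨1, by simp⟩
    · exact ⟨D.t, ht⟩

theorem isConj_outer {a : A} {g : G} :
    IsConj (D.ι a * D.t) g ↔ ∃ c, g = D.ι (a + (c - σ c)) * D.t := by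
  have hc : ∀ c b, D.ι c * (D.ι b * D.t) * (D.ι c)⁻¹ = D.ι (b + (c - σ c)) * D.t := fun c b => by
    rw [D.ι_mul_outer, ← D.map_neg, D.outer_mul_ι, _root_.map_neg]
    congr 2; abel
  rw [isConj_iff]
  constructor
  · rintro ⟨x, rfl⟩
    rcases D.cover x with ⟨c, rfl⟩ | ⟨c, rfl⟩
    · exact ⟨c, hc c a⟩
    -- Conjugating by `t` turns `a` into `σ a = a - (a - σ a)`, which stays in the same coset of the
    -- image of `1 - σ`.
    · refine ⟨c - a, ?_⟩
      have : D.ι c * D.t * (D.ι a * D.t) * (D.ι c * D.t)⁻¹ =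
          D.ι c * (D.ι (σ a) * D.t) * (D.ι c)⁻¹ := by
        rw [← D.conj]; group
      rw [this, hc, map_sub]
      congr 2; abel
  · rintro ⟨c, rfl⟩
    exact ⟨D.ι c, hc c a⟩

theorem mem_center {a : A} : D.ι a ∈ Subgroup.center G ↔ σ a = a := by
  rw [Subgroup.mem_center_iff]
  constructor
  · intro h
    exact (D.ι_comm_outer a 0).1 (h _).symm
  · intro h g
    rcases D.cover g with ⟨b, rfl⟩ | ⟨b, rfl⟩
    · exact D.ι_comm _ _
    · exact ((D.ι_comm_outer a b).2 h).symm

theorem outer_not_mem_center (hσ : ∃ a, σ a ≠ a) (b : A) :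
    D.ι b * D.t ∉ Subgroup.center G := by
  obtain ⟨a, ha⟩ := hσ
  rw [Subgroup.mem_center_iff]
  exact fun h => ha ((D.ι_comm_outer a b).1 (h _))

theorem vertex_cases (v : Vertex G) :
    (∃ a, σ a ≠ a ∧ v.1 = ConjClasses.mk (D.ι a)) ∨ ∃ a, v.1 = ConjClasses.mk (D.ι a * D.t) := by
  obtain ⟨c, x, hx, rfl⟩ := v
  rcases D.cover x with ⟨a, rfl⟩ | ⟨a, rfl⟩
  · exact Or.inl ⟨a, fun h => hx (D.mem_center.2 h), rfl⟩
  · exact Or.inr ⟨a, rfl⟩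

theorem mk_ι_ne (a b : A) : ConjClasses.mk (D.ι a) ≠ ConjClasses.mk (D.ι b * D.t) := by
  rw [Ne, ConjClasses.mk_eq_mk_iff_isConj, D.isConj_ι]
  rintro (h | h) <;> exact D.ι_ne _ _ h.symm

theorem mk_outer_eq {a b : A} :
    ConjClasses.mk (D.ι a * D.t) = ConjClasses.mk (D.ι b * D.t) ↔ ∃ c, b = a + (c - σ c) := by
  rw [ConjClasses.mk_eq_mk_iff_isConj, D.isConj_outer]
  simp only [mul_left_inj, D.inj.eq_iff]

theorem not_adj_ι {v w : Vertex G} {a b : A} (hv : v.1 = ConjClasses.mk (D.ι a))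
    (hw : w.1 = ConjClasses.mk (D.ι b)) : ¬ (graph G).Adj v w := by
  rw [adj_iff hv hw]
  exact fun h => h _ _ (IsConj.refl _) (IsConj.refl _) (D.ι_comm a b)

theorem adj_ι_outer {v w : Vertex G} {a b : A} (ha : σ a ≠ a) (hv : v.1 = ConjClasses.mk (D.ι a))
    (hw : w.1 = ConjClasses.mk (D.ι b * D.t)) : (graph G).Adj v w := by
  rw [adj_iff hv hw]
  intro x y hx hy h
  obtain ⟨c, rfl⟩ := D.isConj_outer.1 hy
  rcases D.isConj_ι.1 hx with rfl | rfl
  · exact ha ((D.ι_comm_outer _ _).1 h)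
  · have := (D.ι_comm_outer _ _).1 h
    rw [D.σ_σ] at this
    exact ha this.symm

/-- Two outer elements commute when the difference of their indices is fixed by `σ`, and conjugation
shifts indices by `im(1 - σ)`. The condition on the right thus says that `a - b` is not in `im(1 -
σ) + ker(1 - σ)`. -/
theorem adj_outer {v w : Vertex G} {a b : A} (hv : v.1 = ConjClasses.mk (D.ι a * D.t))
    (hw : w.1 = ConjClasses.mk (D.ι b * D.t)) :
    (graph G).Adj v w ↔ ¬ ∃ c, σ (a - b - c + σ c) = a - b - c + σ c := by
  rw [adj_iff hv hw]
  constructor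
  · rintro h ⟨c, hc⟩
    refine h (D.ι a * D.t) (D.ι (b + (c - σ c)) * D.t) (IsConj.refl _) (D.isConj_outer.2 ⟨c, rfl⟩)
      ((D.outer_comm_outer _ _).2 ?_)
    rwa [show a - (b + (c - σ c)) = a - b - c + σ c by abel]
  · rintro h x y hx hy e
    obtain ⟨c, rfl⟩ := D.isConj_outer.1 hx
    obtain ⟨d, rfl⟩ := D.isConj_outer.1 hy
    refine h ⟨d - c, ?_⟩
    have := (D.outer_comm_outer _ _).1 e
    rwa [show a + (c - σ c) - (b + (d - σ d)) = a - b - (d - c) + σ (d - c) by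
      rw [map_sub]; abel] at this

theorem card_inner {ι : Type*} [DecidableEq ι] [Finite G] [Finite A]
    (c : Vertex G → ι) (i : ι)
    (h : ∀ v, c v = i ↔ ∃ a, σ a ≠ a ∧ v.1 = ConjClasses.mk (D.ι a)) :
    Nat.card {a // σ a ≠ a} = 2 * fibreCard c i := by
  refine card_eq_mul_fibreCard c i (fun a => σ a ≠ a) D.ι
    (fun a ha hc => ha (D.mem_center.1 hc)) h 2 fun a ha => ?_
  have : {b | σ b ≠ b ∧ IsConj (D.ι a) (D.ι b)} = {a, σ a} := by
    ext b
    rw [Set.mem_ofPred_eq, D.isConj_ι, D.inj.eq_iff, D.inj.eq_iff, Set.mem_insert_iff,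
      Set.mem_singleton_iff, and_iff_right_iff_imp]
    rintro (rfl | rfl)
    · exact ha
    · rw [D.σ_σ]; exact ha.symm
  change Nat.card {b | σ b ≠ b ∧ IsConj (D.ι a) (D.ι b)} = 2
  rw [this, Nat.card_coe_set_eq, Set.ncard_pair ha.symm]

/-- An outer class is indexed by a coset of `im(1 - σ)`, whose order is `|A|` divided by the number
of fixed points of `σ`. -/
theorem card_outer {ι : Type*} [DecidableEq ι] [Finite G] [Finite A] (hσ : ∃ a, σ a ≠ a)
    (c : Vertex G → ι) (i : ι) (p : A → Prop) (hp : ∀ a b, p a → p (a + (b - σ b)))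
    (h : ∀ v, c v = i ↔ ∃ a, p a ∧ v.1 = ConjClasses.mk (D.ι a * D.t)) :
    Nat.card {a // σ a = a} * Nat.card {a // p a} = Nat.card A * fibreCard c i := by
  let φ : A →+ A := AddMonoidHom.id A - σ
  have h1 : Nat.card {a // p a} = Nat.card φ.range * fibreCard c i := by
    refine card_eq_mul_fibreCard c i p (fun a => D.ι a * D.t)
      (fun a _ => D.outer_not_mem_center hσ a) h _ fun a ha => ?_
    refine Nat.card_congr ⟨fun b => ⟨b.1 - a, ?_⟩, fun k => ⟨a + k.1, ?_⟩, fun b => ?_, fun k => ?_⟩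
    · obtain ⟨e, he⟩ := D.isConj_outer.1 b.2.2
      rw [mul_left_inj, D.inj.eq_iff] at he
      exact ⟨e, by rw [he]; simp [φ]⟩
    · obtain ⟨k, e, rfl⟩ := k
      exact ⟨hp a e ha, D.isConj_outer.2 ⟨e, rfl⟩⟩
    · simp
    · simp
  have h2 : Nat.card {a // σ a = a} = Nat.card φ.ker := by
    refine Nat.card_congr (Equiv.subtypeEquivRight fun a => ?_)
    rw [AddMonoidHom.mem_ker, AddMonoidHom.sub_apply, AddMonoidHom.id_apply, sub_eq_zero, eq_comm]
  have h3 : Nat.card φ.ker * Nat.card φ.range = Nat.card A := by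
    rw [← AddSubgroup.index_ker, AddSubgroup.card_mul_index]
  rw [h1, h2, ← mul_assoc, h3]

/-- Here `hb` says that `im(1 - σ) + ker(1 - σ)` is all of `A`, so the outer classes form a single
part. There are as many of them as fixed points, and the inner classes pair up the remaining
elements of `A`. -/
theorem isBipartiteOf [Finite G] [Finite A] (hσ : ∃ a, σ a ≠ a)
    (hb : ∀ a, ∃ c, σ (a - c + σ c) = a - c + σ c) {f p : ℕ} (hf : Nat.card {a // σ a = a} = f)
    (hA : Nat.card A = f + 2 * p) : IsBipartiteOf (graph G) f p := by
  classical
  let c : Vertex G → Fin 2 := fun v => if ∃ a, v.1 = ConjClasses.mk (D.ι a * D.t) then 0 else 1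
  have c0 : ∀ v : Vertex G, (∃ a, v.1 = ConjClasses.mk (D.ι a * D.t)) → c v = 0 := fun v h => if_pos h
  have c1 : ∀ v : Vertex G, (∃ a, σ a ≠ a ∧ v.1 = ConjClasses.mk (D.ι a)) → c v = 1 := by
    rintro v ⟨a, -, ha⟩
    refine if_neg ?_
    rintro ⟨b, hb⟩
    exact D.mk_ι_ne a b (ha.symm.trans hb)
  have i0 : ∀ v : Vertex G, c v = 0 ↔ ∃ a, True ∧ v.1 = ConjClasses.mk (D.ι a * D.t) := fun v => by
    simp only [true_and]
    refine ⟨fun h => ?_, c0 v⟩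
    rcases D.vertex_cases v with h' | h'
    · rw [c1 v h'] at h; exact absurd h (by decide)
    · exact h'
  have i1 : ∀ v : Vertex G, c v = 1 ↔ ∃ a, σ a ≠ a ∧ v.1 = ConjClasses.mk (D.ι a) := fun v => by
    refine ⟨fun h => ?_, c1 v⟩
    rcases D.vertex_cases v with h' | h'
    · exact h'
    · rw [c0 v h'] at h; exact absurd h (by decide)
  refine ⟨c, fun v w => ?_, ?_, ?_⟩
  · rcases D.vertex_cases v with hv | hv <;> rcases D.vertex_cases w with hw | hw
    · rw [c1 v hv, c1 w hw]
      obtain ⟨a, -, hv⟩ := hv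
      obtain ⟨b, -, hw⟩ := hw
      simp [D.not_adj_ι hv hw]
    · rw [c1 v hv, c0 w hw]
      obtain ⟨a, ha, hv⟩ := hv
      obtain ⟨b, hw⟩ := hw
      simp [D.adj_ι_outer ha hv hw]
    · rw [c0 v hv, c1 w hw]
      obtain ⟨a, hv⟩ := hv
      obtain ⟨b, hb, hw⟩ := hw
      simp [(D.adj_ι_outer hb hw hv).symm]
    · rw [c0 v hv, c0 w hw]
      obtain ⟨a, hv⟩ := hv
      obtain ⟨b, hw⟩ := hw
      rw [D.adj_outer hv hw]
      simpa only [ne_eq, not_true_eq_false, iff_false, not_not] using hb (a - b)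
  · have := D.card_outer hσ c 0 (fun _ => True) (fun _ _ _ => trivial) i0
    rw [Nat.card_congr (Equiv.subtypeUnivEquiv fun _ => trivial), mul_comm, hf] at this
    exact (Nat.eq_of_mul_eq_mul_left Nat.card_pos this).symm
  · have h1 := D.card_inner c 1 i1
    have h2 := card_fixed_add σ
    omega

/-- Here `im(1 - σ) + ker(1 - σ)` is the kernel of `χ`, of index two, so the outer classes split
into two equal parts according to `χ`. -/
theorem isTripartiteOf [Finite G] [Finite A] (hσ : ∃ a, σ a ≠ a) (χ : A →+ ZMod 2)
    (hχ : Function.Surjective χ)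
    (hb : ∀ a, χ a = 0 ↔ ∃ c, σ (a - c + σ c) = a - c + σ c) {f p : ℕ}
    (hf : Nat.card {a // σ a = a} = 2 * f) (hA : Nat.card A = 2 * f + 2 * p) :
    IsTripartiteOf (graph G) f p := by
  classical
  have hχK : ∀ b, χ (b - σ b) = 0 := fun b => (hb _).2 ⟨b, by simp⟩
  have hχadd : ∀ a b, χ (a + (b - σ b)) = χ a := fun a b => by rw [_root_.map_add, hχK, add_zero]
  have h01 : ∀ x : ZMod 2, x = 0 ∨ x = 1 := by decide
  let c : Vertex G → Fin 3 := fun v =>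
    if ∃ a, χ a = 0 ∧ v.1 = ConjClasses.mk (D.ι a * D.t) then 0 else
      if ∃ a, χ a = 1 ∧ v.1 = ConjClasses.mk (D.ι a * D.t) then 1 else 2
  have c0 : ∀ v : Vertex G, (∃ a, χ a = 0 ∧ v.1 = ConjClasses.mk (D.ι a * D.t)) → c v = 0 :=
    fun v h => if_pos h
  have c1 : ∀ v : Vertex G, (∃ a, χ a = 1 ∧ v.1 = ConjClasses.mk (D.ι a * D.t)) → c v = 1 := by
    intro v h
    refine (if_neg ?_).trans (if_pos h)
    rintro ⟨b, hb0, hb⟩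
    obtain ⟨a, ha1, ha⟩ := h
    obtain ⟨e, he⟩ := D.mk_outer_eq.1 (ha.symm.trans hb)
    rw [he, hχadd, ha1] at hb0
    exact absurd hb0 (by decide)
  have c2 : ∀ v : Vertex G, (∃ a, σ a ≠ a ∧ v.1 = ConjClasses.mk (D.ι a)) → c v = 2 := by
    rintro v ⟨a, -, ha⟩
    refine (if_neg ?_).trans (if_neg ?_) <;> rintro ⟨b, -, hb⟩ <;>
      exact D.mk_ι_ne a b (ha.symm.trans hb)
  have cases : ∀ v : Vertex G, (∃ a, χ a = 0 ∧ v.1 = ConjClasses.mk (D.ι a * D.t)) ∨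
      (∃ a, χ a = 1 ∧ v.1 = ConjClasses.mk (D.ι a * D.t)) ∨
        ∃ a, σ a ≠ a ∧ v.1 = ConjClasses.mk (D.ι a) := by
    intro v
    rcases D.vertex_cases v with h' | ⟨a, h'⟩
    · exact Or.inr (Or.inr h')
    · rcases h01 (χ a) with h | h
      · exact Or.inl ⟨a, h, h'⟩
      · exact Or.inr (Or.inl ⟨a, h, h'⟩)
  have i0 : ∀ v : Vertex G, c v = 0 ↔ ∃ a, χ a = 0 ∧ v.1 = ConjClasses.mk (D.ι a * D.t) := fun v => by
    refine ⟨fun h => ?_, c0 v⟩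
    rcases cases v with h' | h' | h'
    · exact h'
    · rw [c1 v h'] at h; exact absurd h (by decide)
    · rw [c2 v h'] at h; exact absurd h (by decide)
  have i1 : ∀ v : Vertex G, c v = 1 ↔ ∃ a, χ a = 1 ∧ v.1 = ConjClasses.mk (D.ι a * D.t) := fun v => by
    refine ⟨fun h => ?_, c1 v⟩
    rcases cases v with h' | h' | h'
    · rw [c0 v h'] at h; exact absurd h (by decide)
    · exact h'
    · rw [c2 v h'] at h; exact absurd h (by decide)
  have i2 : ∀ v : Vertex G, c v = 2 ↔ ∃ a, σ a ≠ a ∧ v.1 = ConjClasses.mk (D.ι a) := fun v => by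
    refine ⟨fun h => ?_, c2 v⟩
    rcases cases v with h' | h' | h'
    · rw [c0 v h'] at h; exact absurd h (by decide)
    · rw [c1 v h'] at h; exact absurd h (by decide)
    · exact h'
  have hout : ∀ (v w : Vertex G) (a b : A), v.1 = ConjClasses.mk (D.ι a * D.t) →
      w.1 = ConjClasses.mk (D.ι b * D.t) → ((graph G).Adj v w ↔ χ a ≠ χ b) := by
    intro v w a b hv hw
    rw [D.adj_outer hv hw, ← hb, map_sub, sub_eq_zero]
  have hker : ∀ x, 2 * Nat.card {a // χ a = x} = Nat.card A := by
    have e0 : 2 * Nat.card {a // χ a = 0} = Nat.card A := by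
      have h := AddSubgroup.card_mul_index χ.ker
      rw [AddSubgroup.index_ker, AddMonoidHom.range_eq_top.2 hχ,
        Nat.card_congr AddSubgroup.topEquiv.toEquiv, Nat.card_zmod, mul_comm] at h
      exact h
    intro x
    obtain ⟨u, rfl⟩ := hχ x
    rw [← e0]
    congr 1
    refine Nat.card_congr ⟨fun a => ⟨a.1 - u, ?_⟩, fun a => ⟨a.1 + u, ?_⟩, fun a => ?_, fun a => ?_⟩
    · rw [map_sub, a.2, sub_self]
    · rw [_root_.map_add, a.2, zero_add]
    · simp
    · simp
  have hcount : ∀ (i : Fin 3) (x : ZMod 2),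
      (∀ v : Vertex G, c v = i ↔ ∃ a, χ a = x ∧ v.1 = ConjClasses.mk (D.ι a * D.t)) →
      fibreCard c i = f := by
    intro i x h
    have := D.card_outer hσ c i (fun a => χ a = x) (fun a b ha => (hχadd a b).trans ha) h
    rw [hf, mul_comm 2 f, mul_assoc, hker x, mul_comm] at this
    exact (Nat.eq_of_mul_eq_mul_left Nat.card_pos this).symm
  refine ⟨c, fun v w => ?_, hcount 0 0 i0, hcount 1 1 i1, ?_⟩
  · rcases cases v with hv | hv | hv <;> rcases cases w with hw | hw | hw
    · rw [c0 v hv, c0 w hw]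
      obtain ⟨a, ha, hv⟩ := hv
      obtain ⟨b, hb, hw⟩ := hw
      simp [hout v w a b hv hw, ha, hb]
    · rw [c0 v hv, c1 w hw]
      obtain ⟨a, ha, hv⟩ := hv
      obtain ⟨b, hb, hw⟩ := hw
      simp [hout v w a b hv hw, ha, hb]
    · rw [c0 v hv, c2 w hw]
      obtain ⟨a, ha, hv⟩ := hv
      obtain ⟨b, hb, hw⟩ := hw
      simp [(D.adj_ι_outer hb hw hv).symm]
    · rw [c1 v hv, c0 w hw]
      obtain ⟨a, ha, hv⟩ := hv
      obtain ⟨b, hb, hw⟩ := hw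
      simp [hout v w a b hv hw, ha, hb]
    · rw [c1 v hv, c1 w hw]
      obtain ⟨a, ha, hv⟩ := hv
      obtain ⟨b, hb, hw⟩ := hw
      simp [hout v w a b hv hw, ha, hb]
    · rw [c1 v hv, c2 w hw]
      obtain ⟨a, ha, hv⟩ := hv
      obtain ⟨b, hb, hw⟩ := hw
      simp [(D.adj_ι_outer hb hw hv).symm]
    · rw [c2 v hv, c0 w hw]
      obtain ⟨a, ha, hv⟩ := hv
      obtain ⟨b, hb, hw⟩ := hw
      simp [D.adj_ι_outer ha hv hw]
    · rw [c2 v hv, c1 w hw]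
      obtain ⟨a, ha, hv⟩ := hv
      obtain ⟨b, hb, hw⟩ := hw
      simp [D.adj_ι_outer ha hv hw]
    · rw [c2 v hv, c2 w hw]
      obtain ⟨a, -, hv⟩ := hv
      obtain ⟨b, -, hw⟩ := hw
      simp [D.not_adj_ι hv hw]
  · have h1 := D.card_inner c 2 i2
    have h2 := card_fixed_add σ
    omega

end TwistData

end NCCC

namespace NCCC

/-! ### Multiplication maps on `ZMod k` -/

/-- Fixed points of multiplication by `c` are the elements killed by `e = 1 - c`. -/
theorem card_fixed_mulLeft {k : ℕ} [NeZero k] (c : ZMod k) (e : ℕ) (h : (e : ZMod k) = 1 - c) :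
    Nat.card {a : ZMod k // AddMonoidHom.mulLeft c a = a} = k.gcd e := by
  have := IsAddCyclic.card_nsmulAddMonoidHom_ker (ZMod k) e
  rw [Nat.card_zmod] at this
  rw [← this]
  refine Nat.card_congr (Equiv.subtypeEquivRight fun a => ?_)
  rw [AddMonoidHom.mem_ker, nsmulAddMonoidHom_apply, AddMonoidHom.coe_mulLeft, nsmul_eq_mul, h,
    sub_mul, one_mul, sub_eq_zero, eq_comm]

theorem mulLeft_ne {k : ℕ} (c : ZMod k) (h : c ≠ 1) :
    ∃ a, AddMonoidHom.mulLeft c a ≠ a := ⟨1, by simpa using h⟩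

theorem neg_one_ne_one {k : ℕ} (hk : 3 ≤ k) : (-1 : ZMod k) ≠ 1 := fun h => by
  have : ((2 : ℕ) : ZMod k) = 0 := by push_cast; linear_combination -h
  rw [ZMod.natCast_eq_zero_iff] at this
  exact absurd (Nat.le_of_dvd (by norm_num) this) (by omega)

/-- The parity map on `ZMod k` for even `k`. -/
def parity (k : ℕ) (h : 2 ∣ k) : ZMod k →+ ZMod 2 := (ZMod.castHom h (ZMod 2)).toAddMonoidHom

theorem parity_surjective (k : ℕ) (h : 2 ∣ k) : Function.Surjective (parity k h) :=
  ZMod.castHom_surjective h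

theorem parity_intCast (k : ℕ) (h : 2 ∣ k) (a : ℤ) : parity k h a = a :=
  map_intCast (ZMod.castHom h (ZMod 2)) a

theorem parity_intCast_eq_zero {k : ℕ} (h : 2 ∣ k) (a : ℤ) : parity k h a = 0 ↔ Even a := by
  rw [parity_intCast, ZMod.intCast_zmod_eq_zero_iff_dvd, even_iff_two_dvd]; rfl

theorem exists_mulLeft_neg {k j : ℕ} (h : (k : ℕ) ∣ 2 * (2 * j + 1)) (a : ZMod k) :
    ∃ c, AddMonoidHom.mulLeft (-1) (a - c + AddMonoidHom.mulLeft (-1) c) =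
      a - c + AddMonoidHom.mulLeft (-1) c := by
  have h' := (ZMod.natCast_eq_zero_iff _ _).2 h
  push_cast at h'
  -- This choice gives `a - 2c = (2j + 1) a`, which is killed by 2 and so equals its negative.
  refine ⟨-j * a, ?_⟩
  simp only [AddMonoidHom.coe_mulLeft]
  linear_combination -a * h'

theorem parity_eq_zero_iff_neg {k j : ℕ} (hk : k = 4 * j) (h2 : 2 ∣ k) (a : ZMod k) :
    parity k h2 a = 0 ↔ ∃ c, AddMonoidHom.mulLeft (-1) (a - c + AddMonoidHom.mulLeft (-1) c) =
      a - c + AddMonoidHom.mulLeft (-1) c := by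
  obtain ⟨a, rfl⟩ := ZMod.intCast_surjective a
  rw [parity_intCast_eq_zero]
  simp only [AddMonoidHom.coe_mulLeft]
  constructor
  · rintro ⟨b, rfl⟩
    exact ⟨b, by push_cast; ring⟩
  · rintro ⟨c, hc⟩
    obtain ⟨c, rfl⟩ := ZMod.intCast_surjective c
    have : (((2 * (a - 2 * c) : ℤ)) : ZMod k) = 0 := by push_cast; linear_combination -hc
    rw [ZMod.intCast_zmod_eq_zero_iff_dvd, hk] at this
    obtain ⟨q, hq⟩ := this
    push_cast at hq
    -- From `2 (a - 2c) = 4jq` one gets `a = 2 (c + jq)`.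
    exact ⟨c + j * q, by linarith⟩

/-! ### Groups inverting a cyclic subgroup of index two -/

section Neg

variable {G : Type*} [Group G] [Finite G] {k : ℕ}

theorem isBipartiteOf_of_neg_odd
    (D : TwistData G (AddMonoidHom.mulLeft (-1 : ZMod k))) {j : ℕ} (hk : k = 2 * j + 1)
    (hj : 1 ≤ j) : IsBipartiteOf (graph G) 1 j := by
  have : NeZero k := ⟨by omega⟩
  refine D.isBipartiteOf (mulLeft_ne _ (neg_one_ne_one (by omega)))
    (exists_mulLeft_neg (j := j) ⟨2, by rw [hk]; ring⟩) ?_ (by rw [Nat.card_zmod]; omega)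
  rw [card_fixed_mulLeft _ 2 (by push_cast; ring), hk]
  simp

theorem isBipartiteOf_of_neg_two
    (D : TwistData G (AddMonoidHom.mulLeft (-1 : ZMod k))) {j : ℕ} (hk : k = 4 * j + 2)
    (hj : 1 ≤ j) : IsBipartiteOf (graph G) 2 (2 * j) := by
  have : NeZero k := ⟨by omega⟩
  refine D.isBipartiteOf (mulLeft_ne _ (neg_one_ne_one (by omega)))
    (exists_mulLeft_neg (j := j) ⟨1, by rw [hk]; ring⟩) ?_ (by rw [Nat.card_zmod]; omega)
  rw [card_fixed_mulLeft _ 2 (by push_cast; ring), hk]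
  exact Nat.gcd_eq_right ⟨2 * j + 1, by ring⟩

theorem isTripartiteOf_of_neg
    (D : TwistData G (AddMonoidHom.mulLeft (-1 : ZMod k))) {j : ℕ} (hk : k = 4 * j)
    (hj : 1 ≤ j) : IsTripartiteOf (graph G) 1 (2 * j - 1) := by
  have : NeZero k := ⟨by omega⟩
  have h2 : 2 ∣ k := ⟨2 * j, by omega⟩
  refine D.isTripartiteOf (mulLeft_ne _ (neg_one_ne_one (by omega))) (parity k h2)
    (parity_surjective k h2) (parity_eq_zero_iff_neg hk h2) ?_ (by rw [Nat.card_zmod]; omega)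
  rw [card_fixed_mulLeft _ 2 (by push_cast; ring)]
  exact Nat.gcd_eq_right h2

end Neg

/-- The description of the dihedral group. -/
def dihedralTwist (m : ℕ) :
    TwistData (DihedralGroup m) (AddMonoidHom.mulLeft (-1 : ZMod m)) where
  ι a := .r a
  t := .sr 0
  map_add _ _ := rfl
  inj _ _ h := DihedralGroup.r.inj h
  conj a := by simp
  not_mem a h := by cases h
  cover g := by
    cases g with
    | r a => exact Or.inl ⟨a, rfl⟩
    | sr a => exact Or.inr ⟨-a, by simp⟩

/-- The description of the dicyclic group. -/
def quaternionTwist (m : ℕ) :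
    TwistData (QuaternionGroup m) (AddMonoidHom.mulLeft (-1 : ZMod (2 * m))) where
  ι a := .a a
  t := .xa 0
  map_add _ _ := rfl
  inj _ _ h := QuaternionGroup.a.inj h
  conj a := by simp
  not_mem a h := by cases h
  cover g := by
    cases g with
    | a a => exact Or.inl ⟨a, rfl⟩
    | xa a => exact Or.inr ⟨-a, by simp⟩

/-! ### Presented groups -/

/-- The generators of `G`, hence all elements, have the form `ι a` or `ι a * t`. -/
theorem cover_of_closure {G A : Type*} [Group G] [AddCommGroup A] {σ : A → A} {ι : A → G} {t : G}
    (map_add : ∀ a b, ι (a + b) = ι a * ι b) (conj : ∀ a, t * ι a = ι (σ a) * t) (z : A)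
    (sq : t * t = ι z) (S : Set G) (hS : Subgroup.closure S = ⊤)
    (hgen : ∀ g ∈ S, (∃ a, g = ι a) ∨ ∃ a, g = ι a * t) (g : G) :
    (∃ a, g = ι a) ∨ ∃ a, g = ι a * t := by
  have h0 : ι 0 = 1 := by
    have := map_add 0 0
    rwa [add_zero, left_eq_mul] at this
  have hneg : ∀ a, ι (-a) = (ι a)⁻¹ := fun a => by
    rw [eq_inv_iff_mul_eq_one, ← map_add, neg_add_cancel, h0]
  have hg : g ∈ Subgroup.closure S := hS ▸ Subgroup.mem_top g
  induction hg using Subgroup.closure_induction with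
  | mem x hx => exact hgen x hx
  | one => exact Or.inl ⟨0, h0.symm⟩
  | mul x y _ _ hx hy =>
    rcases hx with ⟨a, rfl⟩ | ⟨a, rfl⟩ <;> rcases hy with ⟨b, rfl⟩ | ⟨b, rfl⟩
    · exact Or.inl ⟨a + b, (map_add a b).symm⟩
    · exact Or.inr ⟨a + b, by rw [map_add, mul_assoc]⟩
    · exact Or.inr ⟨a + σ b, by rw [map_add, mul_assoc, mul_assoc, conj]⟩
    · refine Or.inl ⟨a + σ b + z, ?_⟩
      rw [map_add, map_add, ← sq, mul_assoc, ← mul_assoc t, conj]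
      group
  | inv x _ hx =>
    rcases hx with ⟨a, rfl⟩ | ⟨a, rfl⟩
    · exact Or.inl ⟨-a, (hneg a).symm⟩
    · refine Or.inr ⟨-z + σ (-a), ?_⟩
      rw [map_add, mul_assoc, ← conj, hneg, hneg, ← sq]
      group

theorem pow_val_add {G : Type*} [Group G] {k : ℕ} [NeZero k] {x : G} (h : x ^ k = 1) (a b : ZMod k) :
    x ^ (a + b).val = x ^ a.val * x ^ b.val := by
  rw [ZMod.val_add, ← pow_eq_pow_mod _ h, pow_add]

theorem pow_val_natCast {G : Type*} [Group G] {k : ℕ} {x : G} (h : x ^ k = 1) (a : ℕ) :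
    x ^ (a : ZMod k).val = x ^ a := by
  rw [ZMod.val_natCast, ← pow_eq_pow_mod _ h]

theorem pow_val_neg {G : Type*} [Group G] {k : ℕ} [NeZero k] {x : G} (h : x ^ k = 1) (a : ZMod k) :
    x ^ (-a).val = (x ^ a.val)⁻¹ := by
  rw [eq_inv_iff_mul_eq_one, ← pow_val_add h, neg_add_cancel, ZMod.val_zero, pow_zero]

section Semidihedral

/-- The exponent `2 m - 1` as a residue. -/
def sdUnit (m : ℕ) : ZMod (4 * m) := ((2 * m - 1 : ℕ) : ZMod (4 * m))

theorem four_mul_cast (m : ℕ) : (4 * m : ZMod (4 * m)) = 0 := by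
  exact_mod_cast ZMod.natCast_self (4 * m)

theorem sdUnit_eq {m : ℕ} (hm : 1 ≤ m) : sdUnit m = 2 * m - 1 := by
  rw [sdUnit, Nat.cast_sub (by omega)]; push_cast; ring

theorem sdUnit_mul_self {m : ℕ} (hm : 1 ≤ m) : sdUnit m * sdUnit m = 1 := by
  rw [sdUnit_eq hm]
  linear_combination ((m : ZMod (4 * m)) - 1) * four_mul_cast m

theorem sdUnit_ne_one {m : ℕ} (hm : 2 ≤ m) : sdUnit m ≠ 1 := fun h => by
  have : ((2 * m - 2 : ℕ) : ZMod (4 * m)) = 0 := by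
    rw [sdUnit_eq (by omega)] at h
    rw [Nat.cast_sub (by omega)]; push_cast; linear_combination h
  rw [ZMod.natCast_eq_zero_iff] at this
  exact absurd (Nat.le_of_dvd (by omega) this) (by omega)

/-- The permutations of `ZMod (4 m)` by which the generators of `SD_{8m}` act. -/
def sdPerm (m : ℕ) (hm : 1 ≤ m) : Fin 2 → Equiv.Perm (ZMod (4 * m)) :=
  ![Equiv.addRight 1,
    ⟨fun a => sdUnit m * a, fun a => sdUnit m * a,
      fun a => by simp only [← mul_assoc, sdUnit_mul_self hm, one_mul],
      fun a => by simp only [← mul_assoc, sdUnit_mul_self hm, one_mul]⟩]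

theorem addRight_one_pow {k : ℕ} (n : ℕ) (a : ZMod k) :
    ((Equiv.addRight (1 : ZMod k)) ^ n) a = a + n := by
  induction n with
  | zero => simp
  | succ n ih => rw [pow_succ', Equiv.Perm.mul_apply, ih]; simp [add_assoc]

theorem sdPerm_rels (m : ℕ) (hm : 1 ≤ m) :
    ∀ r ∈ semidihedralRels m, FreeGroup.lift (sdPerm m hm) r = 1 := by
  rintro r (rfl | rfl | rfl)
  · ext1 a
    rw [map_pow, FreeGroup.lift_apply_of]
    change ((Equiv.addRight (1 : ZMod (4 * m))) ^ (4 * m)) a = a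
    rw [addRight_one_pow, ZMod.natCast_self, add_zero]
  · ext1 a
    rw [map_pow, FreeGroup.lift_apply_of, sq]
    change sdUnit m * (sdUnit m * a) = a
    rw [← mul_assoc, sdUnit_mul_self hm, one_mul]
  · rw [map_mul, map_inv, mul_inv_eq_one]
    ext1 a
    simp only [map_mul, map_pow, FreeGroup.lift_apply_of]
    change sdUnit m * (sdUnit m * a + 1) = ((Equiv.addRight (1 : ZMod (4 * m))) ^ (2 * m - 1)) a
    rw [addRight_one_pow, mul_add, ← mul_assoc, sdUnit_mul_self hm, one_mul, mul_one, sdUnit]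

/-- The description of the semidihedral group. -/
def semidihedralTwist (m : ℕ) (hm : 2 ≤ m) :
    TwistData (SemidihedralGroup m) (AddMonoidHom.mulLeft (sdUnit m)) := by
  have hm1 : 1 ≤ m := by omega
  have : NeZero (4 * m) := ⟨by omega⟩
  let x : SemidihedralGroup m := PresentedGroup.of 0
  let y : SemidihedralGroup m := PresentedGroup.of 1
  have hx : x ^ (4 * m) = 1 :=
    PresentedGroup.one_of_mem (rels := semidihedralRels m) (x := FreeGroup.of 0 ^ (4 * m))
      (Or.inl rfl)
  have hy : y * y = 1 := by
    rw [← sq]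
    exact PresentedGroup.one_of_mem (rels := semidihedralRels m) (x := FreeGroup.of 1 ^ 2)
      (Or.inr (Or.inl rfl))
  have hyx : y * x * y = x ^ (2 * m - 1) := by
    rw [← mul_inv_eq_one]
    exact PresentedGroup.one_of_mem (rels := semidihedralRels m)
      (x := FreeGroup.of 1 * FreeGroup.of 0 * FreeGroup.of 1 * (FreeGroup.of 0 ^ (2 * m - 1))⁻¹)
      (Or.inr (Or.inr rfl))
  -- The relations alone do not exclude a collapse of the group. The action on `ZMod (4 m)`, with
  -- `x` translating by one and `y` multiplying by `2 m - 1`, separates the powers of `x` and keeps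
  -- `y` apart from them.
  let ρ := PresentedGroup.toGroup (sdPerm_rels m hm1)
  have ρx : ∀ (n : ℕ) b, ρ (x ^ n) b = b + n := fun n b => by
    rw [map_pow, PresentedGroup.toGroup.of]
    exact addRight_one_pow n b
  have ρy : ∀ b, ρ y b = sdUnit m * b := fun b => by
    rw [PresentedGroup.toGroup.of]
    rfl
  have hadd : ∀ a b : ZMod (4 * m), x ^ (a + b).val = x ^ a.val * x ^ b.val := pow_val_add hx
  have hpow : ∀ n : ℕ, y * x ^ n = x ^ ((2 * m - 1) * n) * y := fun n => by
    have hinv : y⁻¹ = y := inv_eq_of_mul_eq_one_left hy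
    have h1 : (y * x * y⁻¹) ^ n = y * x ^ n * y⁻¹ := conj_pow
    rw [hinv, hyx] at h1
    rw [pow_mul, h1, mul_assoc, hy, mul_one]
  have hconj : ∀ a : ZMod (4 * m),
      y * x ^ a.val = x ^ (AddMonoidHom.mulLeft (sdUnit m) a).val * y := fun a => by
    rw [hpow, ← pow_val_natCast hx, Nat.cast_mul, ZMod.natCast_zmod_val]
    rfl
  refine ⟨fun a => x ^ a.val, y, hadd, fun a b h => ?_, hconj, fun a h => ?_, ?_⟩
  · have := congrArg (fun g => ρ g 0) h
    simpa only [ρx, ZMod.natCast_zmod_val, zero_add] using this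
  · have h0 := congrArg (fun g => ρ g 0) h
    have h1 := congrArg (fun g => ρ g 1) h
    simp only [ρx, ρy, ZMod.natCast_zmod_val, zero_add, mul_zero, mul_one] at h0 h1
    rw [h0, add_zero] at h1
    exact sdUnit_ne_one hm h1.symm
  · refine cover_of_closure hadd hconj 0 (by simpa using hy) _
      (PresentedGroup.closure_range_of (semidihedralRels m)) ?_
    rintro _ ⟨i, rfl⟩
    fin_cases i
    · exact Or.inl ⟨((1 : ℕ) : ZMod (4 * m)), by rw [pow_val_natCast hx, pow_one]; rfl⟩
    · exact Or.inr ⟨0, by simp [y]⟩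

end Semidihedral

section U

/-- The permutations of `ZMod m × ZMod (2 n)` by which the generators of `U_{(n,m)}` act. -/
def uPerm (n m : ℕ) : Fin 2 → Equiv.Perm (ZMod m × ZMod (2 * n)) :=
  ![(Equiv.neg (ZMod m)).prodCongr (Equiv.addRight 1),
    (Equiv.addRight 1).prodCongr (Equiv.refl (ZMod (2 * n)))]

theorem uPerm_one_pow (n m k : ℕ) (a : ZMod m × ZMod (2 * n)) :
    (uPerm n m 1 ^ k) a = (a.1 + k, a.2) := by
  induction k with
  | zero => simp
  | succ k ih => rw [pow_succ', Equiv.Perm.mul_apply, ih]; simp [uPerm, add_assoc]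

theorem uPerm_zero_sq_pow (n m k : ℕ) (a : ZMod m × ZMod (2 * n)) :
    ((uPerm n m 0 ^ 2) ^ k) a = (a.1, a.2 + (2 * k : ℕ)) := by
  induction k with
  | zero => simp
  | succ k ih =>
    rw [pow_succ', Equiv.Perm.mul_apply, ih, sq, Equiv.Perm.mul_apply]
    simp [uPerm]; ring

theorem uPerm_rels (n m : ℕ) : ∀ r ∈ uRels n m, FreeGroup.lift (uPerm n m) r = 1 := by
  rintro r (rfl | rfl | rfl)
  · ext1 a
    rw [map_pow, FreeGroup.lift_apply_of, pow_mul, uPerm_zero_sq_pow, ZMod.natCast_self, add_zero]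
    rfl
  · ext1 a
    rw [map_pow, FreeGroup.lift_apply_of, uPerm_one_pow, ZMod.natCast_self, add_zero]
    rfl
  · rw [map_mul, map_inv, mul_inv_eq_one, map_mul, map_mul, map_inv, map_inv, mul_assoc,
      inv_mul_eq_iff_eq_mul, eq_mul_inv_iff_mul_eq]
    ext1 a
    simp only [FreeGroup.lift_apply_of, Equiv.Perm.mul_apply]
    refine Prod.ext ?_ ?_ <;> simp [uPerm]

/-- The description of `U_{(n,m)}`. -/
def uTwist (n m : ℕ) (hn : 1 ≤ n) (hm : 1 ≤ m) :
    TwistData (UGroup n m)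
      ((AddMonoidHom.id (ZMod n)).prodMap (AddMonoidHom.mulLeft (-1 : ZMod m))) := by
  have : NeZero n := ⟨by omega⟩
  have : NeZero m := ⟨by omega⟩
  have : NeZero (2 * n) := ⟨by omega⟩
  let x : UGroup n m := PresentedGroup.of 0
  let y : UGroup n m := PresentedGroup.of 1
  have hx : (x ^ 2) ^ n = 1 := by
    rw [← pow_mul]
    exact PresentedGroup.one_of_mem (rels := uRels n m) (x := FreeGroup.of 0 ^ (2 * n)) (Or.inl rfl)
  have hy : y ^ m = 1 :=
    PresentedGroup.one_of_mem (rels := uRels n m) (x := FreeGroup.of 1 ^ m) (Or.inr (Or.inl rfl))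
  have hxy : x⁻¹ * y * x = y⁻¹ := by
    rw [← mul_inv_eq_one]
    exact PresentedGroup.one_of_mem (rels := uRels n m)
      (x := (FreeGroup.of 0)⁻¹ * FreeGroup.of 1 * FreeGroup.of 0 * ((FreeGroup.of 1)⁻¹)⁻¹)
      (Or.inr (Or.inr rfl))
  have hyx : y * x = x * y⁻¹ := by rw [← hxy]; group
  have hxy' : x * y = y⁻¹ * x := by
    rw [eq_inv_mul_iff_mul_eq, ← mul_assoc, hyx, inv_mul_cancel_right]
  have hconj1 : x * y * x⁻¹ = y⁻¹ := by rw [hxy', mul_inv_cancel_right]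
  have hcomm : Commute (x ^ 2) y := by
    rw [commute_iff_eq, sq, mul_assoc, hxy', ← mul_assoc, ← hyx, mul_assoc]
  let ι : ZMod n × ZMod m → UGroup n m := fun a => (x ^ 2) ^ a.1.val * y ^ a.2.val
  have hadd : ∀ a b, ι (a + b) = ι a * ι b := fun a b => by
    change (x ^ 2) ^ (a.1 + b.1).val * y ^ (a.2 + b.2).val = _ * _ * (_ * _)
    rw [pow_val_add hx, pow_val_add hy, mul_assoc, mul_assoc, ← mul_assoc _ (y ^ a.2.val),
      (hcomm.pow_pow b.1.val a.2.val).eq, mul_assoc]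
  have hconj : ∀ a, x * ι a =
      ι ((AddMonoidHom.id (ZMod n)).prodMap (AddMonoidHom.mulLeft (-1 : ZMod m)) a) * x := fun a => by
    have h : x * y ^ a.2.val = y ^ (-a.2).val * x := by
      rw [pow_val_neg hy, ← inv_pow, ← hconj1, conj_pow, inv_mul_cancel_right]
    change x * ((x ^ 2) ^ a.1.val * y ^ a.2.val) =
      (x ^ 2) ^ a.1.val * y ^ (-1 * a.2).val * x
    rw [neg_one_mul, mul_assoc, ← h, ← mul_assoc, ← mul_assoc, ← pow_mul,
      ((Commute.refl x).pow_right _).eq]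
  let ρ := PresentedGroup.toGroup (uPerm_rels n m)
  -- The orbit of `(0, 0)` recovers both coordinates of `a`. Its second entry is represented by an
  -- even number below `2 n`, whereas `x` moves `(0, 0)` to `(0, 1)`; hence `x` is not in the image
  -- of `ι`.
  have ρι : ∀ a, ρ (ι a) (0, 0) = (a.2, ((2 * a.1.val : ℕ) : ZMod (2 * n))) := fun a => by
    have h0 : ρ x = uPerm n m 0 := PresentedGroup.toGroup.of _
    have h1 : ρ y = uPerm n m 1 := PresentedGroup.toGroup.of _
    rw [map_mul, map_pow, map_pow, map_pow, h0, h1, Equiv.Perm.mul_apply, uPerm_one_pow,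
      uPerm_zero_sq_pow, ZMod.natCast_zmod_val, zero_add, zero_add]
  have ρx : ρ x (0, 0) = (0, 1) := by
    have h0 : ρ x = uPerm n m 0 := PresentedGroup.toGroup.of _
    rw [h0]
    simp [uPerm]
  have hlt : ∀ a : ZMod n, 2 * a.val < 2 * n := fun a => by have := a.val_lt; omega
  refine ⟨ι, x, hadd, fun a b h => ?_, hconj, fun a h => ?_, ?_⟩
  · have h := congrArg (fun g => ρ g (0, 0)) h
    simp only [ρι, Prod.mk.injEq] at h
    have h2 := congrArg ZMod.val h.2
    rw [ZMod.val_natCast_of_lt (hlt _), ZMod.val_natCast_of_lt (hlt _)] at h2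
    exact Prod.ext (ZMod.val_injective n (by omega)) h.1
  · have h := congrArg (fun g => ρ g (0, 0)) h
    simp only [ρι, ρx, Prod.mk.injEq] at h
    have h2 := congrArg ZMod.val h.2
    have h1 : (1 : ZMod (2 * n)).val = 1 := by
      rw [← Nat.cast_one, ZMod.val_natCast_of_lt (by omega)]
    rw [ZMod.val_natCast_of_lt (hlt _), h1] at h2
    omega
  · refine cover_of_closure hadd hconj (((1 : ℕ) : ZMod n), 0) ?_ _
      (PresentedGroup.closure_range_of (uRels n m)) ?_
    · change x * x = (x ^ 2) ^ ((1 : ℕ) : ZMod n).val * y ^ (0 : ZMod m).val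
      rw [pow_val_natCast hx, ZMod.val_zero, pow_zero, pow_one, mul_one, sq]
    · rintro _ ⟨i, rfl⟩
      fin_cases i
      · exact Or.inr ⟨0, by simp [ι, x]⟩
      · refine Or.inl ⟨(0, ((1 : ℕ) : ZMod m)), ?_⟩
        change y = (x ^ 2) ^ (0 : ZMod n).val * y ^ ((1 : ℕ) : ZMod m).val
        rw [pow_val_natCast hy, ZMod.val_zero, pow_zero, pow_one, one_mul]

end U

end NCCC

namespace NCCC

/-! ### The graphs of the presented groups -/

theorem isBipartiteOf_semidihedral {G : Type*} [Group G] [Finite G] {m j : ℕ} (hm : m = 2 * j + 1)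
    (hj : 1 ≤ j) (D : TwistData G (AddMonoidHom.mulLeft (sdUnit m))) :
    IsBipartiteOf (graph G) 4 (4 * j) := by
  have : NeZero (4 * m) := ⟨by omega⟩
  have h4 := four_mul_cast m
  have hu := sdUnit_eq (m := m) (by omega)
  have hmj : (m : ZMod (4 * m)) = 2 * j + 1 := by
    have := congrArg (Nat.cast : ℕ → ZMod (4 * m)) hm
    push_cast at this
    exact this
  refine D.isBipartiteOf (mulLeft_ne _ (sdUnit_ne_one (by omega))) (fun a => ⟨(j + 1) * a, ?_⟩) ?_
    (by rw [Nat.card_zmod]; omega)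
  · simp only [AddMonoidHom.coe_mulLeft, hu]
    -- With `m = 2j + 1` one has `(2m - 2)(j + 1) = m² - 1`. The result `m² a` is fixed because `(2m
    -- - 2) m² = 4j m²` is a multiple of `4m`.
    have key : a - (j + 1) * a + (2 * m - 1) * ((j + 1) * a) = m * m * a := by
      have : (m : ZMod (4 * m)) * m - (2 * m - 2) * (j + 1) = 1 := by
        rw [hmj]; ring
      linear_combination (-a) * this
    rw [key]
    linear_combination (j * m * a : ZMod (4 * m)) * h4 + 2 * m * m * a * hmj
  · rw [card_fixed_mulLeft _ (2 * m + 2) (by push_cast; rw [hu]; linear_combination h4),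
      hm, show 2 * (2 * j + 1) + 2 = 4 * (j + 1) by ring,
      Nat.gcd_mul_left]
    have : Nat.gcd (2 * j + 1) (j + 1) = 1 := by
      rw [show 2 * j + 1 = j + (j + 1) by ring, Nat.gcd_add_self_left]
      simp
    rw [this]

theorem isTripartiteOf_semidihedral {G : Type*} [Group G] [Finite G] {m j : ℕ} (hm : m = 2 * j)
    (hj : 1 ≤ j) (D : TwistData G (AddMonoidHom.mulLeft (sdUnit m))) :
    IsTripartiteOf (graph G) 1 (4 * j - 1) := by
  have : NeZero (4 * m) := ⟨by omega⟩
  have h4 := four_mul_cast m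
  have hu := sdUnit_eq (m := m) (by omega)
  have hmj : (m : ZMod (4 * m)) = 2 * j := by
    have := congrArg (Nat.cast : ℕ → ZMod (4 * m)) hm
    push_cast at this
    exact this
  have h2 : 2 ∣ 4 * m := ⟨2 * m, by ring⟩
  refine D.isTripartiteOf (mulLeft_ne _ (sdUnit_ne_one (by omega))) (parity _ h2)
    (parity_surjective _ h2) (fun a => ?_) ?_ (by rw [Nat.card_zmod]; omega)
  · obtain ⟨a, rfl⟩ := ZMod.intCast_surjective a
    rw [parity_intCast_eq_zero]
    simp only [AddMonoidHom.coe_mulLeft, hu]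
    constructor
    · rintro ⟨b, rfl⟩
      refine ⟨b, ?_⟩
      push_cast
      linear_combination ((m - 1) * b : ZMod (4 * m)) * h4
    · rintro ⟨c, hc⟩
      obtain ⟨c, rfl⟩ := ZMod.intCast_surjective c
      have : (((2 * m - 2) * (a + (2 * m - 2) * c) : ℤ) : ZMod (4 * m)) = 0 := by
        push_cast; linear_combination hc
      rw [ZMod.intCast_zmod_eq_zero_iff_dvd, hm] at this
      obtain ⟨q, hq⟩ := this
      push_cast at hq
      -- Here `hq` reduces to `(2j - 1)(a + (4j - 2) c) = 4jq`; substituting it into `a = 2ja - (2j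
      -- - 1) a` exhibits half of `a`.
      refine ⟨j * a - (2 * j - 1) * c + (2 * j - 1) * (2 * j * c) - 2 * j * q, ?_⟩
      linarith
  · rw [card_fixed_mulLeft _ (2 * m + 2) (by push_cast; rw [hu]; linear_combination h4), hm,
      show 4 * (2 * j) = 2 * (4 * j) by ring, show 2 * (2 * j) + 2 = 2 * (2 * j + 1) by ring,
      Nat.gcd_mul_left]
    congr 1
    rw [show 4 * j = 2 * j + 2 * j by ring]
    have h1 : Nat.Coprime 2 (2 * j + 1) := by simp
    have h2 : Nat.Coprime (2 * j) (2 * j + 1) := by simp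
    rw [← two_mul]
    exact h1.mul_left h2

section U

variable {G : Type*} [Group G] [Finite G] {n m : ℕ}

theorem card_fixed_prodMap [NeZero m] :
    Nat.card {a : ZMod n × ZMod m //
      (AddMonoidHom.id (ZMod n)).prodMap (AddMonoidHom.mulLeft (-1 : ZMod m)) a = a} =
      n * m.gcd 2 := by
  rw [← card_fixed_mulLeft (-1 : ZMod m) 2 (by push_cast; ring)]
  refine Eq.trans (Nat.card_congr (β := ZMod n × {b : ZMod m // AddMonoidHom.mulLeft (-1) b = b}) ?_)
    (by rw [Nat.card_prod, Nat.card_zmod])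
  exact ⟨fun a => (a.1.1, ⟨a.1.2, congrArg Prod.snd a.2⟩),
    fun a => ⟨(a.1, a.2.1), Prod.ext rfl a.2.2⟩, fun _ => rfl, fun _ => rfl⟩

/-- The first coordinate is fixed by the involution and imposes no condition, so the cyclic case
decides. -/
theorem exists_prodMap_iff (a : ZMod n × ZMod m) :
    (∃ c, (AddMonoidHom.id (ZMod n)).prodMap (AddMonoidHom.mulLeft (-1 : ZMod m))
        (a - c + (AddMonoidHom.id (ZMod n)).prodMap (AddMonoidHom.mulLeft (-1 : ZMod m)) c) =
      a - c + (AddMonoidHom.id (ZMod n)).prodMap (AddMonoidHom.mulLeft (-1 : ZMod m)) c) ↔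
    ∃ c, AddMonoidHom.mulLeft (-1) (a.2 - c + AddMonoidHom.mulLeft (-1) c) =
      a.2 - c + AddMonoidHom.mulLeft (-1) c :=
  ⟨fun ⟨c, hc⟩ => ⟨c.2, congrArg Prod.snd hc⟩, fun ⟨c, hc⟩ => ⟨(0, c), Prod.ext rfl hc⟩⟩

theorem prodMap_ne (hm : 3 ≤ m) :
    ∃ a, (AddMonoidHom.id (ZMod n)).prodMap (AddMonoidHom.mulLeft (-1 : ZMod m)) a ≠ a := by
  obtain ⟨b, hb⟩ := mulLeft_ne _ (neg_one_ne_one hm)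
  exact ⟨(0, b), fun h => hb (congrArg Prod.snd h)⟩

variable (D : TwistData G ((AddMonoidHom.id (ZMod n)).prodMap (AddMonoidHom.mulLeft (-1 : ZMod m))))
include D

theorem isBipartiteOf_u_odd (hn : 1 ≤ n) {j : ℕ} (hm : m = 2 * j + 1) (hj : 1 ≤ j) :
    IsBipartiteOf (graph G) n (n * j) := by
  have : NeZero m := ⟨by omega⟩
  have : NeZero n := ⟨by omega⟩
  refine D.isBipartiteOf (prodMap_ne (by omega)) (fun a => (exists_prodMap_iff a).2
    (exists_mulLeft_neg (j := j) ⟨2, by rw [hm]; ring⟩ _)) ?_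
    (by rw [Nat.card_prod, Nat.card_zmod, Nat.card_zmod, hm]; ring)
  rw [card_fixed_prodMap, hm]
  simp

theorem isBipartiteOf_u_two (hn : 1 ≤ n) {j : ℕ} (hm : m = 4 * j + 2) (hj : 1 ≤ j) :
    IsBipartiteOf (graph G) (2 * n) (2 * n * j) := by
  have : NeZero m := ⟨by omega⟩
  have : NeZero n := ⟨by omega⟩
  refine D.isBipartiteOf (prodMap_ne (by omega)) (fun a => (exists_prodMap_iff a).2
    (exists_mulLeft_neg (j := j) ⟨1, by rw [hm]; ring⟩ _)) ?_
    (by rw [Nat.card_prod, Nat.card_zmod, Nat.card_zmod, hm]; ring)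
  rw [card_fixed_prodMap, Nat.gcd_eq_right ⟨2 * j + 1, by rw [hm]; ring⟩, mul_comm]

theorem isTripartiteOf_u (hn : 1 ≤ n) {j : ℕ} (hm : m = 4 * j) (hj : 1 ≤ j) :
    IsTripartiteOf (graph G) n (n * (2 * j - 1)) := by
  have : NeZero m := ⟨by omega⟩
  have : NeZero n := ⟨by omega⟩
  have h2 : 2 ∣ m := ⟨2 * j, by omega⟩
  refine D.isTripartiteOf (prodMap_ne (by omega))
    ((parity m h2).comp (AddMonoidHom.snd (ZMod n) (ZMod m)))
    ((parity_surjective m h2).comp Prod.snd_surjective)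
    (fun a => (parity_eq_zero_iff_neg hm h2 a.2).trans (exists_prodMap_iff a).symm) ?_ ?_
  · rw [card_fixed_prodMap, Nat.gcd_eq_right h2, mul_comm]
  · rw [Nat.card_prod, Nat.card_zmod, Nat.card_zmod, hm]
    obtain ⟨i, rfl⟩ : ∃ i, j = i + 1 := ⟨j - 1, by omega⟩
    rw [show 2 * (i + 1) - 1 = 2 * i + 1 by omega]
    ring

end U

/-! ### Comparison with the complete graph -/

/-- `Γ` is border-energetic in each of the three senses iff `e`, is never hyperenergetic, is not
L-hyperenergetic iff `l`, and is not Q-hyperenergetic iff `q`. -/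
def Verdict {V : Type*} [Fintype V] (Γ : SimpleGraph V) (e l q : Prop) : Prop :=
  (IsBorderenergetic Γ ↔ e) ∧ ¬ IsHyperenergetic Γ ∧ (IsLBorderenergetic Γ ↔ e) ∧
    (¬ IsLHyperenergetic Γ ↔ l) ∧ (IsQBorderenergetic Γ ↔ e) ∧ (¬ IsQHyperenergetic Γ ↔ q)

section Compare

variable {V : Type*} [Fintype V] {Γ : SimpleGraph V}

theorem Verdict.of_energies [Nonempty V] {e l q : Prop} {N : ℕ} (hN : Fintype.card V = N)
    (h : (energy Γ = 2 * ((N : ℝ) - 1) ↔ e) ∧ energy Γ ≤ 2 * ((N : ℝ) - 1) ∧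
      (lEnergy Γ = 2 * ((N : ℝ) - 1) ↔ e) ∧ (lEnergy Γ ≤ 2 * ((N : ℝ) - 1) ↔ l) ∧
      (qEnergy Γ = 2 * ((N : ℝ) - 1) ↔ e) ∧ (qEnergy Γ ≤ 2 * ((N : ℝ) - 1) ↔ q)) :
    Verdict Γ e l q := by
  obtain ⟨h1, h2, h3⟩ := energies_completeOn Γ
  have hN' : (Fintype.card V : ℝ) = N := by rw [hN]
  simpa only [Verdict, IsBorderenergetic, IsHyperenergetic, IsLBorderenergetic, IsLHyperenergetic,
    IsQBorderenergetic, IsQHyperenergetic, gt_iff_lt, not_lt, h1, h2, h3, hN'] using h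

theorem iffs_of_lt {x y : ℝ} {e l : Prop} (h : x < y) (he : ¬ e) (hl : l) :
    (x = y ↔ e) ∧ (x ≤ y ↔ l) :=
  ⟨iff_of_false h.ne he, iff_of_true h.le hl⟩

theorem iffs_of_gt {x y : ℝ} {e l : Prop} (h : y < x) (he : ¬ e) (hl : ¬ l) :
    (x = y ↔ e) ∧ (x ≤ y ↔ l) :=
  ⟨iff_of_false h.ne' he, iff_of_false h.not_ge hl⟩

theorem iffs_of_eq {x y : ℝ} {e l : Prop} (h : x = y) (he : e) (hl : l) :
    (x = y ↔ e) ∧ (x ≤ y ↔ l) :=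
  ⟨iff_of_true h he, iff_of_true h.le hl⟩

theorem Verdict.star {b : ℕ} (h : IsBipartiteOf Γ 1 b) (hb : 1 ≤ b) :
    Verdict Γ (b = 1) True True := by
  obtain ⟨h1, h2, h3, h4⟩ := h.energies one_pos hb
  have : Nonempty V := Fintype.card_pos_iff.1 (by omega)
  have hb' : (1 : ℝ) ≤ b := by exact_mod_cast hb
  have hpos : (0 : ℝ) < 1 + b := by linarith
  have key : ((|(b : ℝ) - (1 : ℕ)| * (2 * (1 : ℕ) * b - ((1 : ℕ) + b)) + ((1 : ℕ) + b) ^ 2) /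
        ((1 : ℕ) + b) = 2 * (((1 + b : ℕ) : ℝ) - 1) ↔ b = 1) ∧
      ((|(b : ℝ) - (1 : ℕ)| * (2 * (1 : ℕ) * b - ((1 : ℕ) + b)) + ((1 : ℕ) + b) ^ 2) /
        ((1 : ℕ) + b) ≤ 2 * (((1 + b : ℕ) : ℝ) - 1) ↔ True) := by
    push_cast
    rw [abs_of_nonneg (by linarith)]
    rcases hb.eq_or_lt with rfl | hlt
    · exact iffs_of_eq (by norm_num) rfl trivial
    · have : (1 : ℝ) < b := by exact_mod_cast hlt
      refine iffs_of_lt ?_ (by omega) trivial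
      rw [div_lt_iff₀ hpos]
      nlinarith
  refine Verdict.of_energies h4 ?_
  rw [h1, h2, h3]
  have hs : √(b : ℝ) ^ 2 = b := Real.sq_sqrt (by linarith)
  refine ⟨?_, ?_, key.1, key.2, key.1, key.2⟩
  · rw [Nat.cast_one, one_mul]
    push_cast
    constructor
    · intro h
      have : √(b : ℝ) = b := by linarith
      rw [this] at hs
      have : (b : ℝ) = 1 := by nlinarith
      exact_mod_cast this
    · rintro rfl; norm_num
  · have : √(b : ℝ) ≤ b := by
      rw [Real.sqrt_le_left (by linarith)]; nlinarith
    rw [Nat.cast_one, one_mul]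
    push_cast
    linarith

theorem Verdict.bipartite {n j : ℕ} (hn : 2 ≤ n) (hj : 1 ≤ j) (h : IsBipartiteOf Γ n (n * j)) :
    Verdict Γ False (j = 1 ∨ j = 2 ∧ n = 2) (j = 1 ∨ j = 2 ∧ n = 2) := by
  obtain ⟨h1, h2, h3, h4⟩ := h.energies (by omega) (Nat.mul_pos (by omega) hj)
  have : Nonempty V := Fintype.card_pos_iff.1 (by omega)
  have hn' : (2 : ℝ) ≤ n := by exact_mod_cast hn
  have hj' : (1 : ℝ) ≤ j := by exact_mod_cast hj
  have hnj : (n : ℝ) ≤ n * j := by nlinarith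
  have key : ((|((n * j : ℕ) : ℝ) - n| * (2 * n * (n * j : ℕ) - (n + (n * j : ℕ))) +
        (n + (n * j : ℕ)) ^ 2) / (n + (n * j : ℕ)) = 2 * (((n + n * j : ℕ) : ℝ) - 1) ↔ False) ∧
      ((|((n * j : ℕ) : ℝ) - n| * (2 * n * (n * j : ℕ) - (n + (n * j : ℕ))) +
        (n + (n * j : ℕ)) ^ 2) / (n + (n * j : ℕ)) ≤ 2 * (((n + n * j : ℕ) : ℝ) - 1) ↔
          (j = 1 ∨ j = 2 ∧ n = 2)) := by
    push_cast
    have hpos : (0 : ℝ) < n + n * j := by linarith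
    rw [abs_of_nonneg (by linarith)]
    by_cases hcase : j = 1 ∨ j = 2 ∧ n = 2
    · refine iffs_of_lt ?_ id hcase
      rw [div_lt_iff₀ hpos]
      rcases hcase with rfl | ⟨rfl, rfl⟩
      · push_cast; nlinarith
      · norm_num
    · refine iffs_of_gt ?_ id hcase
      rw [lt_div_iff₀ hpos]
      -- After clearing the denominator, the energy excess over the complete graph is `n` times this
      -- expression. At `j = 2` it equals `4n² - 12n + 6`, negative at `n = 2` and positive from `n
      -- = 3` on, which explains the isolated exception.
      have main : (0 : ℝ) <
          (j - 1) * n * (2 * n * j - j - 1) - (j + 1) * (n * (j + 1) - 2) := by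
        rcases (show j = 2 ∨ 3 ≤ j by omega) with rfl | hj3
        · have : (3 : ℝ) ≤ n := by exact_mod_cast (show 3 ≤ n by omega)
          push_cast; nlinarith
        · have hj3' : (3 : ℝ) ≤ j := by exact_mod_cast hj3
          have e1 : (0 : ℝ) ≤ (j - 1) * n * ((2 * n - 4) * j) := by
            refine mul_nonneg (mul_nonneg ?_ ?_) (mul_nonneg ?_ ?_) <;> linarith
          have e2 : (0 : ℝ) ≤ n * (2 * j * (j - 3)) := by
            refine mul_nonneg ?_ (mul_nonneg ?_ ?_) <;> linarith
          nlinarith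
      have := mul_pos (show (0 : ℝ) < n by linarith) main
      linarith
  refine Verdict.of_energies h4 ?_
  rw [h1, h2, h3]
  have hlt : √((n : ℝ) * (n * j : ℕ)) < n + n * j - 1 := by
    rw [Real.sqrt_lt' (by nlinarith)]
    push_cast
    have e1 : (n * j + 1 : ℝ) ^ 2 ≤ (n + n * j - 1) ^ 2 := by
      apply pow_le_pow_left₀ (by nlinarith); linarith
    nlinarith [mul_nonneg (mul_nonneg (show (0 : ℝ) ≤ n by linarith) (show (0 : ℝ) ≤ n * j by linarith)) (show (0 : ℝ) ≤ j - 1 by linarith)]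
  refine ⟨iff_of_false (ne_of_lt ?_) id, ?_, key.1, key.2, key.1, key.2⟩ <;> push_cast at hlt ⊢ <;>
    linarith

/-- At `k = 1` the graph is a triangle, hence complete. The case `k = 3` is the only one where the
Laplacian and signless Laplacian energies fall on opposite sides of the bound. -/
theorem Verdict.tripartite_one {k : ℕ} (hk : Odd k) (h : IsTripartiteOf Γ 1 k) :
    Verdict Γ (k = 1) (k = 1) (k = 1 ∨ k = 3) := by
  have hk1 : 1 ≤ k := hk.pos
  obtain ⟨h1, h2, h3, h4⟩ := h.energies one_pos hk1
  have : Nonempty V := Fintype.card_pos_iff.1 (by omega)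
  have hk' : (1 : ℝ) ≤ k := by exact_mod_cast hk1
  refine Verdict.of_energies h4 ?_
  rw [h1, h2, h3]
  push_cast
  have hs : √((1 : ℝ) ^ 2 + 8 * 1 * k) ^ 2 = 1 + 8 * k := by
    rw [Real.sq_sqrt (by linarith)]; ring
  have hs0 := Real.sqrt_nonneg ((1 : ℝ) ^ 2 + 8 * 1 * k)
  have r1 : √((1 : ℝ) ^ 2 + 8 * 1 * 1) = 3 := by
    rw [show ((1 : ℝ) ^ 2 + 8 * 1 * 1) = 3 ^ 2 by norm_num]; exact Real.sqrt_sq (by norm_num)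
  rcases (show k = 1 ∨ k = 3 ∨ 5 ≤ k by obtain ⟨i, rfl⟩ := hk; omega) with rfl | hk3
  · norm_num at r1 ⊢
  have hk3' : (3 : ℝ) ≤ k := by exact_mod_cast (show 3 ≤ k by omega)
  have hlt : 1 + √((1 : ℝ) ^ 2 + 8 * 1 * k) < 2 * (2 + k - 1) := by nlinarith
  have hL := iffs_of_gt (e := k = 1) (l := k = 1)
    (x := (((k : ℝ) - 1) * (4 * 1 * k - 2 * 1 - 2 * k) + 6 * 1 ^ 2 + 2 * k ^ 2 + 4 * 1 * k) /
      (2 * 1 + k)) (y := 2 * (2 + (k : ℝ) - 1)) (by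
        rw [lt_div_iff₀ (by linarith)]; nlinarith) (by omega) (by omega)
  refine ⟨iff_of_false hlt.ne (by omega), hlt.le, hL.1, hL.2, ?_⟩
  rcases hk3 with rfl | hk5
  · refine iffs_of_lt ?_ (by omega) (by omega)
    -- The rest of the energy is `9 / 5`, so anything below `6.2` suffices to stay under 8.
    have : √((3 : ℝ) ^ 2 + 8 * 1 * 3) < 6.1 := by
      rw [Real.sqrt_lt' (by norm_num)]; norm_num
    push_cast
    norm_num at this ⊢
    linarith
  · have hk5' : (5 : ℝ) ≤ k := by exact_mod_cast hk5
    refine iffs_of_gt ?_ (by omega) (by omega)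
    -- The target `2k + 2` is split as `k + 2` from the square root and `k` from the quotient.
    have hS : (k : ℝ) + 2 ≤ √((k : ℝ) ^ 2 + 8 * 1 * k) := Real.le_sqrt_of_sq_le (by nlinarith)
    have hA := le_abs_self ((k : ℝ) ^ 2 - 2 * 1 * k - 2 * 1 ^ 2)
    have : (k : ℝ) < (((k : ℝ) - 1) * (4 * 1 * k - 2 * 1 - 2 * k) +
        |(k : ℝ) ^ 2 - 2 * 1 * k - 2 * 1 ^ 2|) / (2 * 1 + k) := by
      rw [lt_div_iff₀ (by linarith)]; nlinarith
    exact lt_of_eq_of_lt (by ring) (add_lt_add_of_lt_of_le this hS)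

theorem Verdict.tripartite {n k : ℕ} (hn : 2 ≤ n) (hk : Odd k) (h : IsTripartiteOf Γ n (n * k)) :
    Verdict Γ False (k = 1) (k = 1) := by
  have hk1 : 1 ≤ k := hk.pos
  obtain ⟨h1, h2, h3, h4⟩ := h.energies (by omega) (Nat.le_mul_of_pos_right n hk1)
  have : Nonempty V := Fintype.card_pos_iff.1 (by omega)
  have hn' : (2 : ℝ) ≤ n := by exact_mod_cast hn
  have hk' : (1 : ℝ) ≤ k := by exact_mod_cast hk1
  have hn0 : (0 : ℝ) < n := by linarith
  have hnk : (n : ℝ) ≤ n * k := by nlinarith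
  refine Verdict.of_energies h4 ?_
  rw [h1, h2, h3]
  push_cast
  have hlt : n + √((n : ℝ) ^ 2 + 8 * n * (n * k)) < 2 * (2 * n + n * k - 1) := by
    have : √((n : ℝ) ^ 2 + 8 * n * (n * k)) < 2 * n + 2 * (n * k) := by
      rw [Real.sqrt_lt' (by linarith)]
      nlinarith
    linarith
  refine ⟨iff_of_false hlt.ne id, hlt.le, ?_⟩
  rw [← and_assoc]
  rcases (show k = 1 ∨ 3 ≤ k by obtain ⟨i, rfl⟩ := hk; omega) with rfl | hk3
  · refine ⟨iffs_of_lt ?_ id rfl, iffs_of_lt ?_ id rfl⟩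
    · rw [div_lt_iff₀ (by linarith)]
      push_cast; nlinarith
    · simp only [Nat.cast_one, mul_one]
      have r1 : √((n : ℝ) ^ 2 + 8 * n * n) = 3 * n := by
        rw [show (n : ℝ) ^ 2 + 8 * n * n = (3 * n) ^ 2 by ring]
        exact Real.sqrt_sq (by linarith)
      have r2 : |(n : ℝ) ^ 2 - 2 * n * n - 2 * n ^ 2| = 3 * (n : ℝ) ^ 2 := by
        rw [abs_of_nonpos (by nlinarith)]; ring
      have r3 : (((n : ℝ) - n) * (4 * n * n - 2 * n - 2 * n) + 3 * (n : ℝ) ^ 2) / (2 * n + n) = n := by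
        field_simp; ring
      rw [r1, r2, r3]
      linarith
  · have hk3' : (3 : ℝ) ≤ k := by exact_mod_cast hk3
    have e1 : (0 : ℝ) ≤ (n : ℝ) ^ 2 * ((k - 1) * ((4 * n - 8) * k)) := by
      refine mul_nonneg (sq_nonneg _) (mul_nonneg ?_ (mul_nonneg ?_ ?_)) <;> linarith
    have e2 : (0 : ℝ) ≤ (n : ℝ) ^ 2 * (k * (k - 3)) := by
      refine mul_nonneg (sq_nonneg _) (mul_nonneg ?_ ?_) <;> linarith
    have e3 : (0 : ℝ) ≤ (n : ℝ) ^ 2 * (k - 3) :=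
      mul_nonneg (sq_nonneg _) (by linarith)
    have e4 : (0 : ℝ) < (n : ℝ) ^ 2 := by positivity
    refine ⟨iffs_of_gt ?_ id (by omega), iffs_of_gt ?_ id (by omega)⟩
    · rw [lt_div_iff₀ (by linarith)]
      nlinarith
    -- The target `2 (2n + nk - 1)` is split into `2n + nk` from the square root and `2n + nk - 2`
    -- from the quotient.
    · have hS : 2 * (n : ℝ) + n * k ≤ √(((n : ℝ) * k) ^ 2 + 8 * n * (n * k)) :=
        Real.le_sqrt_of_sq_le (by nlinarith)
      have hA := le_abs_self (((n : ℝ) * k) ^ 2 - 2 * n * (n * k) - 2 * n ^ 2)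
      have : 2 * (n : ℝ) + n * k - 2 < (((n : ℝ) * k - n) * (4 * n * (n * k) - 2 * n - 2 * (n * k)) +
          |((n : ℝ) * k) ^ 2 - 2 * n * (n * k) - 2 * n ^ 2|) / (2 * n + n * k) := by
        rw [lt_div_iff₀ (by linarith)]
        nlinarith
      linarith

end Compare

end NCCC

/-! ### Verdicts for the four families and their assembly -/

namespace NCCC

/-- The hypotheses apply to every isomorphism of `G` with a family member, so possible coincidences
between families need no separate treatment. -/
theorem borderIff_of_families {G : Type*} [Group G] (hG : IsFamilyMember G) {P : Prop}
    (hD : ∀ m, 3 ≤ m → Nonempty (G ≃* DihedralGroup m) → (P ↔ m = 3 ∨ m = 4))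
    (hT : ∀ m, 2 ≤ m → Nonempty (G ≃* QuaternionGroup m) → (P ↔ m = 2))
    (hS : ∀ m, 2 ≤ m → Nonempty (G ≃* SemidihedralGroup m) → (P ↔ False))
    (hU : ∀ n m, 2 ≤ n → 3 ≤ m → Nonempty (G ≃* UGroup n m) → (P ↔ False)) :
    P ↔ Nonempty (G ≃* DihedralGroup 3) ∨ Nonempty (G ≃* DihedralGroup 4) ∨
      Nonempty (G ≃* QuaternionGroup 2) := by
  constructor
  · intro h
    rcases hG with ⟨m, hm, e⟩ | ⟨m, hm, e⟩ | ⟨m, hm, e⟩ | ⟨n, m, hn, hm, e⟩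
    · rcases (hD m hm e).1 h with rfl | rfl
      · exact Or.inl e
      · exact Or.inr (Or.inl e)
    · obtain rfl := (hT m hm e).1 h
      exact Or.inr (Or.inr e)
    · exact ((hS m hm e).1 h).elim
    · exact ((hU n m hn hm e).1 h).elim
  · rintro (e | e | e)
    · exact (hD 3 (by norm_num) e).2 (by norm_num)
    · exact (hD 4 (by norm_num) e).2 (by norm_num)
    · exact (hT 2 (by norm_num) e).2 rfl

variable {G : Type*} [Group G] [Finite G]

theorem Verdict.congr {V : Type*} [Fintype V] {Γ : SimpleGraph V} {e l q e' l' q' : Prop}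
    (h : Verdict Γ e l q) (he : e ↔ e') (hl : l ↔ l') (hq : q ↔ q') : Verdict Γ e' l' q' := by
  rwa [← propext he, ← propext hl, ← propext hq]

theorem verdict_neg {k : ℕ} (hk : 3 ≤ k) (D : TwistData G (AddMonoidHom.mulLeft (-1 : ZMod k))) :
    Verdict (graph G) (k = 3 ∨ k = 4) (Odd k ∨ k = 4 ∨ k = 6 ∨ k = 10)
      (Odd k ∨ k = 4 ∨ k = 6 ∨ k = 8 ∨ k = 10) := by
  rw [← Nat.not_even_iff_odd, Nat.even_iff]
  rcases (show (∃ j, k = 2 * j + 1) ∨ (∃ j, k = 4 * j + 2) ∨ ∃ j, k = 4 * j by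
    rcases (show k % 2 = 1 ∨ k % 4 = 2 ∨ k % 4 = 0 by omega) with h | h | h
    · exact Or.inl ⟨k / 2, by omega⟩
    · exact Or.inr (Or.inl ⟨k / 4, by omega⟩)
    · exact Or.inr (Or.inr ⟨k / 4, by omega⟩)) with ⟨j, hj⟩ | ⟨j, hj⟩ | ⟨j, hj⟩
  · have := Verdict.star (isBipartiteOf_of_neg_odd D hj (by omega)) (by omega)
    refine this.congr ?_ ?_ ?_ <;> constructor <;> intro h <;> first | trivial | omega
  -- The graph is `K_{2,2j}`, so `n = 2`, and `j = 1`, `j = 2` correspond to `k = 6`, `k = 10`.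
  · have := Verdict.bipartite le_rfl (by omega) (isBipartiteOf_of_neg_two D hj (by omega))
    refine this.congr ?_ ?_ ?_ <;> constructor <;> intro h <;> first | trivial | omega
  · have := Verdict.tripartite_one ⟨j - 1, by omega⟩ (isTripartiteOf_of_neg D hj (by omega))
    refine this.congr ?_ ?_ ?_ <;> constructor <;> intro h <;> first | trivial | omega

theorem verdict_dihedral {m : ℕ} (hm : 3 ≤ m) (e : G ≃* DihedralGroup m) :
    Verdict (graph G) (m = 3 ∨ m = 4) (Odd m ∨ m = 4 ∨ m = 6 ∨ m = 10)
      (Odd m ∨ m = 4 ∨ m = 6 ∨ m = 8 ∨ m = 10) :=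
  verdict_neg hm ((dihedralTwist m).ofEquiv e)

theorem verdict_quaternion {m : ℕ} (hm : 2 ≤ m) (e : G ≃* QuaternionGroup m) :
    Verdict (graph G) (m = 2) (m = 2 ∨ m = 3 ∨ m = 5) (m = 2 ∨ m = 3 ∨ m = 4 ∨ m = 5) := by
  have ho : ¬ Odd (2 * m) := by simp
  have := verdict_neg (k := 2 * m) (by omega) ((quaternionTwist m).ofEquiv e)
  simp only [ho, false_or] at this
  exact this.congr (by omega) (by omega) (by omega)

theorem verdict_semidihedral {m : ℕ} (hm : 2 ≤ m) (e : G ≃* SemidihedralGroup m) :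
    Verdict (graph G) False (m = 3) (m = 2 ∨ m = 3) := by
  have D := (semidihedralTwist m hm).ofEquiv e
  rcases m.even_or_odd' with ⟨j, hj | hj⟩
  · have := Verdict.tripartite_one ⟨2 * j - 1, by omega⟩ (isTripartiteOf_semidihedral hj (by omega) D)
    refine this.congr ?_ ?_ ?_ <;> constructor <;> intro h <;> first | trivial | omega
  -- The graph is `K_{4,4j}`; as `n = 4`, only `j = 1`, that is `m = 3`, stays below the bound.
  · have := Verdict.bipartite (by norm_num) (by omega) (isBipartiteOf_semidihedral hj (by omega) D)
    refine this.congr ?_ ?_ ?_ <;> constructor <;> intro h <;> first | trivial | omega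

theorem verdict_u {n m : ℕ} (hn : 2 ≤ n) (hm : 3 ≤ m) (e : G ≃* UGroup n m) :
    Verdict (graph G) False (m = 3 ∨ m = 4 ∨ m = 6 ∨ n = 2 ∧ m = 5)
      (m = 3 ∨ m = 4 ∨ m = 6 ∨ n = 2 ∧ m = 5) := by
  have D := (uTwist n m (by omega) (by omega)).ofEquiv e
  rcases (show (∃ j, m = 2 * j + 1) ∨ (∃ j, m = 4 * j + 2) ∨ ∃ j, m = 4 * j by
    rcases (show m % 2 = 1 ∨ m % 4 = 2 ∨ m % 4 = 0 by omega) with h | h | h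
    · exact Or.inl ⟨m / 2, by omega⟩
    · exact Or.inr (Or.inl ⟨m / 4, by omega⟩)
    · exact Or.inr (Or.inr ⟨m / 4, by omega⟩)) with ⟨j, hj⟩ | ⟨j, hj⟩ | ⟨j, hj⟩
  · have := Verdict.bipartite hn (by omega) (isBipartiteOf_u_odd D (by omega) hj (by omega))
    refine this.congr ?_ ?_ ?_ <;> constructor <;> intro h <;> first | trivial | omega
  · have := Verdict.bipartite (by omega) (by omega) (isBipartiteOf_u_two D (by omega) hj (by omega))
    refine this.congr ?_ ?_ ?_ <;> constructor <;> intro h <;> first | trivial | omega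
  · have := Verdict.tripartite hn ⟨j - 1, by omega⟩ (isTripartiteOf_u D (by omega) hj (by omega))
    refine this.congr ?_ ?_ ?_ <;> constructor <;> intro h <;> first | trivial | omega


end NCCC

theorem corollary4p4 {G : Type*} [Group G] [Finite G] (hG : NCCC.IsFamilyMember G) :
    (NCCC.IsBorderenergetic (NCCC.graph G) ↔
      Nonempty (G ≃* DihedralGroup 3) ∨ Nonempty (G ≃* DihedralGroup 4) ∨
        Nonempty (G ≃* QuaternionGroup 2)) ∧
    ¬ NCCC.IsHyperenergetic (NCCC.graph G) ∧
    (NCCC.IsLBorderenergetic (NCCC.graph G) ↔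
      Nonempty (G ≃* DihedralGroup 3) ∨ Nonempty (G ≃* DihedralGroup 4) ∨
        Nonempty (G ≃* QuaternionGroup 2)) ∧
    (¬ NCCC.IsLHyperenergetic (NCCC.graph G) ↔
      (Nonempty (G ≃* DihedralGroup 3) ∨ Nonempty (G ≃* DihedralGroup 4) ∨
        Nonempty (G ≃* QuaternionGroup 2)) ∨
      (∃ m : ℕ, Odd m ∧ 5 ≤ m ∧ Nonempty (G ≃* DihedralGroup m)) ∨
      (∃ m : ℕ, (m = 6 ∨ m = 10) ∧ Nonempty (G ≃* DihedralGroup m)) ∨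
      (∃ m : ℕ, (m = 3 ∨ m = 5) ∧ Nonempty (G ≃* QuaternionGroup m)) ∨
      Nonempty (G ≃* NCCC.SemidihedralGroup 3) ∨
      (∃ n m : ℕ, 2 ≤ n ∧ (m = 3 ∨ m = 4 ∨ m = 6) ∧ Nonempty (G ≃* NCCC.UGroup n m)) ∨
      Nonempty (G ≃* NCCC.UGroup 2 5)) ∧
    (NCCC.IsQBorderenergetic (NCCC.graph G) ↔
      Nonempty (G ≃* DihedralGroup 3) ∨ Nonempty (G ≃* DihedralGroup 4) ∨
        Nonempty (G ≃* QuaternionGroup 2)) ∧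
    (¬ NCCC.IsQHyperenergetic (NCCC.graph G) ↔
      (Nonempty (G ≃* DihedralGroup 3) ∨ Nonempty (G ≃* DihedralGroup 4) ∨
        Nonempty (G ≃* QuaternionGroup 2)) ∨
      (∃ m : ℕ, Odd m ∧ 5 ≤ m ∧ Nonempty (G ≃* DihedralGroup m)) ∨
      (∃ m : ℕ, (m = 6 ∨ m = 8 ∨ m = 10) ∧ Nonempty (G ≃* DihedralGroup m)) ∨
      (∃ m : ℕ, (m = 3 ∨ m = 4 ∨ m = 5) ∧ Nonempty (G ≃* QuaternionGroup m)) ∨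
      (∃ m : ℕ, (m = 2 ∨ m = 3) ∧ Nonempty (G ≃* NCCC.SemidihedralGroup m)) ∨
      (∃ n m : ℕ, 2 ≤ n ∧ (m = 3 ∨ m = 4 ∨ m = 6) ∧ Nonempty (G ≃* NCCC.UGroup n m)) ∨
      Nonempty (G ≃* NCCC.UGroup 2 5)) := by
  have dih : ∀ m, 3 ≤ m → Nonempty (G ≃* DihedralGroup m) → _ :=
    fun m hm e => NCCC.verdict_dihedral hm e.some
  have quat : ∀ m, 2 ≤ m → Nonempty (G ≃* QuaternionGroup m) → _ :=
    fun m hm e => NCCC.verdict_quaternion hm e.some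
  have semi : ∀ m, 2 ≤ m → Nonempty (G ≃* NCCC.SemidihedralGroup m) → _ :=
    fun m hm e => NCCC.verdict_semidihedral hm e.some
  have ugr : ∀ n m, 2 ≤ n → 3 ≤ m → Nonempty (G ≃* NCCC.UGroup n m) → _ :=
    fun n m hn hm e => NCCC.verdict_u hn hm e.some
  refine ⟨?_, ?_, ?_, ?_, ?_, ?_⟩
  · exact NCCC.borderIff_of_families hG (fun m hm e => (dih m hm e).1)
      (fun m hm e => (quat m hm e).1) (fun m hm e => (semi m hm e).1)
      (fun n m hn hm e => (ugr n m hn hm e).1)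
  · rcases hG with ⟨m, hm, e⟩ | ⟨m, hm, e⟩ | ⟨m, hm, e⟩ | ⟨n, m, hn, hm, e⟩
    · exact (dih m hm e).2.1
    · exact (quat m hm e).2.1
    · exact (semi m hm e).2.1
    · exact (ugr n m hn hm e).2.1
  · exact NCCC.borderIff_of_families hG (fun m hm e => (dih m hm e).2.2.1)
      (fun m hm e => (quat m hm e).2.2.1) (fun m hm e => (semi m hm e).2.2.1)
      (fun n m hn hm e => (ugr n m hn hm e).2.2.1)
  · constructor
    · intro h
      rcases hG with ⟨m, hm, e⟩ | ⟨m, hm, e⟩ | ⟨m, hm, e⟩ | ⟨n, m, hn, hm, e⟩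
      · rcases (dih m hm e).2.2.2.1.1 h with h | rfl | h
        · rcases (show m = 3 ∨ 5 ≤ m by obtain ⟨j, rfl⟩ := h; omega) with rfl | h5
          · exact Or.inl (Or.inl e)
          · exact Or.inr (Or.inl ⟨m, h, h5, e⟩)
        · exact Or.inl (Or.inr (Or.inl e))
        · exact Or.inr (Or.inr (Or.inl ⟨m, h, e⟩))
      · rcases (quat m hm e).2.2.2.1.1 h with rfl | h
        · exact Or.inl (Or.inr (Or.inr e))
        · exact Or.inr (Or.inr (Or.inr (Or.inl ⟨m, h, e⟩)))
      · obtain rfl := (semi m hm e).2.2.2.1.1 h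
        exact Or.inr (Or.inr (Or.inr (Or.inr (Or.inl e))))
      · rcases (show (m = 3 ∨ m = 4 ∨ m = 6) ∨ n = 2 ∧ m = 5 by
          simpa only [or_assoc] using (ugr n m hn hm e).2.2.2.1.1 h) with h | ⟨rfl, rfl⟩
        · exact Or.inr (Or.inr (Or.inr (Or.inr (Or.inr (Or.inl ⟨n, m, hn, h, e⟩)))))
        · exact Or.inr (Or.inr (Or.inr (Or.inr (Or.inr (Or.inr e)))))
    · rintro ((e | e | e) | ⟨m, ho, hm, e⟩ | ⟨m, hm, e⟩ | ⟨m, hm, e⟩ | e | ⟨n, m, hn, hm, e⟩ | e)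
      · exact (dih 3 (by norm_num) e).2.2.2.1.2 (by decide)
      · exact (dih 4 (by norm_num) e).2.2.2.1.2 (by decide)
      · exact (quat 2 (by norm_num) e).2.2.2.1.2 (by decide)
      · exact (dih m (by omega) e).2.2.2.1.2 (Or.inl ho)
      · exact (dih m (by omega) e).2.2.2.1.2 (Or.inr (Or.inr hm))
      · exact (quat m (by omega) e).2.2.2.1.2 (Or.inr hm)
      · exact (semi 3 (by norm_num) e).2.2.2.1.2 rfl
      · exact (ugr n m hn (by omega) e).2.2.2.1.2 (by omega)
      · exact (ugr 2 5 le_rfl (by norm_num) e).2.2.2.1.2 (by decide)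
  · exact NCCC.borderIff_of_families hG (fun m hm e => (dih m hm e).2.2.2.2.1)
      (fun m hm e => (quat m hm e).2.2.2.2.1) (fun m hm e => (semi m hm e).2.2.2.2.1)
      (fun n m hn hm e => (ugr n m hn hm e).2.2.2.2.1)
  · constructor
    · intro h
      rcases hG with ⟨m, hm, e⟩ | ⟨m, hm, e⟩ | ⟨m, hm, e⟩ | ⟨n, m, hn, hm, e⟩
      · rcases (dih m hm e).2.2.2.2.2.1 h with h | rfl | h
        · rcases (show m = 3 ∨ 5 ≤ m by obtain ⟨j, rfl⟩ := h; omega) with rfl | h5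
          · exact Or.inl (Or.inl e)
          · exact Or.inr (Or.inl ⟨m, h, h5, e⟩)
        · exact Or.inl (Or.inr (Or.inl e))
        · exact Or.inr (Or.inr (Or.inl ⟨m, h, e⟩))
      · rcases (quat m hm e).2.2.2.2.2.1 h with rfl | h
        · exact Or.inl (Or.inr (Or.inr e))
        · exact Or.inr (Or.inr (Or.inr (Or.inl ⟨m, h, e⟩)))
      · have h := (semi m hm e).2.2.2.2.2.1 h
        exact Or.inr (Or.inr (Or.inr (Or.inr (Or.inl ⟨m, h, e⟩))))
      · rcases (show (m = 3 ∨ m = 4 ∨ m = 6) ∨ n = 2 ∧ m = 5 by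
          simpa only [or_assoc] using (ugr n m hn hm e).2.2.2.2.2.1 h) with h | ⟨rfl, rfl⟩
        · exact Or.inr (Or.inr (Or.inr (Or.inr (Or.inr (Or.inl ⟨n, m, hn, h, e⟩)))))
        · exact Or.inr (Or.inr (Or.inr (Or.inr (Or.inr (Or.inr e)))))
    · rintro ((e | e | e) | ⟨m, ho, hm, e⟩ | ⟨m, hm, e⟩ | ⟨m, hm, e⟩ | ⟨m, hm, e⟩ |
        ⟨n, m, hn, hm, e⟩ | e)
      · exact (dih 3 (by norm_num) e).2.2.2.2.2.2 (by decide)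
      · exact (dih 4 (by norm_num) e).2.2.2.2.2.2 (by decide)
      · exact (quat 2 (by norm_num) e).2.2.2.2.2.2 (by decide)
      · exact (dih m (by omega) e).2.2.2.2.2.2 (Or.inl ho)
      · exact (dih m (by omega) e).2.2.2.2.2.2 (Or.inr (Or.inr hm))
      · exact (quat m (by omega) e).2.2.2.2.2.2 (Or.inr hm)
      · exact (semi m (by omega) e).2.2.2.2.2.2 hm
      · exact (ugr n m hn (by omega) e).2.2.2.2.2.2 (by omega)
      · exact (ugr 2 5 le_rfl (by norm_num) e).2.2.2.2.2.2 (by decide)
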